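/- Let $\delta\ge 0$ be an integer and let $S_\delta$ be the complex Hirzebruch surface, i.e. the quotient of $(\mathbb{C}^2\setminus\{0\})\times(\mathbb{C}^2\setminus\{0\})$, with coordinates $(X_0,X_1,Y_0,Y_1)$, by the torus action $(\lambda,\mu)\cdot(X_0,X_1,Y_0,Y_1)=(\lambda X_0,\lambda X_1,\mu Y_0,\lambda^{-\delta}\mu Y_1)$; let $\pi$ be the quotient map. A polynomial is bi-homogeneous of bi-degree $(d_1,d_2)$ if it is so for the grading in which $X_0,X_1,Y_0,Y_1$ have bi-degrees $(1,0),(1,0),(0,1),(-\delta,1)$; such polynomials are the sections of the line bundle $\mathcal{O}(d_1,d_2)$. Let $\Theta$ be the tangent sheaf of $S_\delta$ and $\Theta(d_1,d_2)=\Theta\otimes\mathcal{O}(d_1,d_2)$. A section $s\in H^0(S_\delta,\Theta(d_1,d_2))$ is represented by an affine vector field $X=V_0\frac{\partial}{\partial X_0}+V_1\frac{\partial}{\partial X_1}+W_0\frac{\partial}{\partial Y_0}+W_1\frac{\partial}{\partial Y_1}$, where $V_0,V_1,W_0,W_1$ are bi-homogeneous of bi-degrees $(d_1+1,d_2),(d_1+1,d_2),(d_1,d_2+1),(d_1-\delta,d_2+1)$,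 if $s$ is the image of $X$ under $d\pi$. The singular scheme $Z_s$ of $s$ is the closed subscheme of $S_\delta$ whose ideal is generated, on each of the four charts $\{X_i\ne0,Y_j\ne0\}\cong\mathbb{C}^2$, by the two coefficients of the vector field that defines $s$. For sections $s,s'$ write $[s]=[s']$ if both are non-zero and define the same point of $\mathbb{P}H^0(S_\delta,\Theta(d_1,d_2))$. A global endomorphism $\Phi$ of $TS_\delta$ has matrix $A$, a $4\times4$ matrix over $\mathbb{C}[X_0,X_1,Y_0,Y_1]$, if $\Phi\circ d\pi=d\pi\circ A$. Fix integers $d_1,d_2$ such that every section of $\Theta(d_1,d_2)$ is represented by an affine vector field. Let $s\in H^0(S_\delta,\Theta(d_1,d_2))$ and let $\Phi\neq0$ be a global endomorphism of $TS_\delta$. Then: (1) $Z_s\subseteq Z_{\Phi(s)}$, and $Z_s=Z_{\Phi(s)}$ if $\Phi$ is invertible. (2) If $\delta=1$, then $\Phi$ is invertible, and $[\Phi(s)]=[s]$ if $s\ne0$. If $\delta=0$, then $\Phi$ has the matrix $A(a,d)=\mathrm{diag}(a,a,d,d)$ for exactly one pair $(a,d)\in\mathbb{C}^2$. If moreover $\Phi$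 is invertible, $s\neq0$, and $X$ is any affine vector field that represents $s$, then $[\Phi(s)]=[s]$ if and only if $a=d$ or $X_0V_1-X_1V_0=0$ or $Y_0W_1-Y_1W_0=0$. In particular, if $\Phi$ is invertible, $s\ne0$ and $\dim Z_s\le0$ ($Z_s$ finite or empty), then $[\Phi(s)]=[s]$ if and only if $a=d$. If $\delta\ge2$, then $\Phi$ has the matrix $$A(a,C)=\begin{pmatrix}a&0&0&0\\0&a&0&0\\X_1Y_1C&-X_0Y_1C&a&0\\0&0&0&a\end{pmatrix}$$ for exactly one pair $(a,C)$ of a number $a\in\mathbb{C}$ and a homogeneous polynomial $C\in\mathbb{C}[X_0,X_1]$ of degree $\delta-2$ (possibly zero). If moreover $\Phi$ is invertible, $s\ne0$, and $X$ is any affine vector field that represents $s$, then $[\Phi(s)]=[s]$ if and only if $C=0$, or $C\neq0$ and $X_0V_1-X_1V_0=0$. (3) If $\Phi$ is not invertible and $\Phi(s)\ne0$, then $Z_{\Phi(s)}$ is one-dimensional. -/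

import Mathlib

open MvPolynomial

noncomputable section

namespace Hirzebruch

/-! The Hirzebruch surface `S_δ` is the quotient of `(ℂ² ∖ 0) × (ℂ² ∖ 0)`, with coordinates
`(X₀, X₁, Y₀, Y₁) = (P 0, P 1, P 2, P 3)`, by the torus action
`(l, m) • (X₀, X₁, Y₀, Y₁) = (l X₀, l X₁, m Y₀, l ^ (-δ) m Y₁)`.
It is glued from the four charts `U i j = {X i ≠ 0, Y j ≠ 0} ≅ ℂ²`. -/

/-- The indices `(i, j)` of the four charts `U i j`. -/
abbrev Chart := Fin 2 × Fin 2

/-- Regular functions on one chart: polynomials in `(x, y)`. -/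
abbrev ChartRing := MvPolynomial (Fin 2) ℂ

/-- The ring `ℂ[X₀, X₁, Y₀, Y₁]`. -/
abbrev CoxRing := MvPolynomial (Fin 4) ℂ

/-- Position of the homogeneous coordinate `X i`. -/
def xIdx (i : Fin 2) : Fin 4 := ![0, 1] i

/-- Position of the homogeneous coordinate `Y j`. -/
def yIdx (j : Fin 2) : Fin 4 := ![2, 3] j

/-- The representative with `X i = 1` and `Y j = 1` of the point of `U i j` whose chart
coordinates are `p = (x, y)`. -/
def lift (c : Chart) (p : Fin 2 → ℂ) : Fin 4 → ℂ :=
  ![if c.1 = 0 then 1 else p 0, if c.1 = 0 then p 0 else 1,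
    if c.2 = 0 then 1 else p 1, if c.2 = 0 then p 1 else 1]

/-- The quotient map read in the chart `U i j`: the chart coordinates of the point with homogeneous
coordinates `P`, namely `x = X_{1-i} / X_i`, and `y = X_i ^ δ Y₁ / Y₀` if `j = 0`,
`y = Y₀ / (X_i ^ δ Y₁)` if `j = 1`. -/
def coord (δ : ℕ) (c : Chart) (P : Fin 4 → ℂ) : Fin 2 → ℂ :=
  ![P (xIdx c.1.rev) / P (xIdx c.1),
    if c.2 = 0 then P (xIdx c.1) ^ δ * P 3 / P 2 else P 2 / (P (xIdx c.1) ^ δ * P 3)]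

/-- The part of the chart `c`, in the coordinates of `c`, that also lies in the chart `c'`. -/
def overlap (c c' : Chart) : Set (Fin 2 → ℂ) :=
  {p | lift c p (xIdx c'.1) ≠ 0 ∧ lift c p (yIdx c'.2) ≠ 0}

/-- The change of coordinates from the chart `c` to the chart `c'`. -/
def trans (δ : ℕ) (c c' : Chart) (p : Fin 2 → ℂ) : Fin 2 → ℂ := coord δ c' (lift c p)

/-- The torus element `(l, m)` that makes the `X i` and `Y j` coordinates of `P` equal to `1`:
`l = X_i⁻¹`, and `m = Y₀⁻¹` if `j = 0`, `m = (X_i ^ δ Y₁)⁻¹` if `j = 1`. -/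
def normalizer (δ : ℕ) (c : Chart) (P : Fin 4 → ℂ) : ℂ × ℂ :=
  ((P (xIdx c.1))⁻¹, if c.2 = 0 then (P 2)⁻¹ else (P (xIdx c.1) ^ δ * P 3)⁻¹)

/-- The transition function of the line bundle `𝒪(d₁, d₂)` from the chart `c` to the chart `c'`.
A bi-homogeneous `H` of bi-degree `(d₁, d₂)` is the section whose expression in the chart `c` is
`H ∘ lift c`, and `H ((l, m) • P) = l ^ d₁ * m ^ d₂ * H P`. -/
def twist (δ : ℕ) (d₁ d₂ : ℤ) (c c' : Chart) (p : Fin 2 → ℂ) : ℂ :=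
  (normalizer δ c' (lift c p)).1 ^ d₁ * (normalizer δ c' (lift c p)).2 ^ d₂

/-- The value at `p` of a vector of polynomials. -/
def evalVec {n : ℕ} {σ : Type} (p : σ → ℂ) (v : Fin n → MvPolynomial σ ℂ) : Fin n → ℂ :=
  fun k => eval p (v k)

/-- The value at `p` of a matrix of polynomials. -/
def evalMat {n : ℕ} {σ : Type} (p : σ → ℂ) (A : Matrix (Fin n) (Fin n) (MvPolynomial σ ℂ)) :
    Matrix (Fin n) (Fin n) ℂ :=
  A.map (eval p)

theorem evalVec_mulVec {n : ℕ} {σ : Type} (p : σ → ℂ)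
    (A : Matrix (Fin n) (Fin n) (MvPolynomial σ ℂ)) (v : Fin n → MvPolynomial σ ℂ) :
    evalVec p (A.mulVec v) = (evalMat p A).mulVec (evalVec p v) := by
  funext k
  simp [evalVec, evalMat, Matrix.mulVec, dotProduct]

/-- `H⁰(S_δ, Θ(d₁, d₂))`, where `Θ` is the tangent sheaf: a section is a regular vector field
(with its two coefficients) on each chart; on overlaps the vector fields correspond to each other
under the derivative of the change of coordinates, up to the transition function of
`𝒪(d₁, d₂)`. -/
def sections (δ : ℕ) (d₁ d₂ : ℤ) : Submodule ℂ (Chart → Fin 2 → ChartRing) where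
  carrier := {s | ∀ c c' : Chart, ∀ p ∈ overlap c c',
    evalVec (trans δ c c' p) (s c') =
      twist δ d₁ d₂ c c' p • fderiv ℂ (trans δ c c') p (evalVec p (s c))}
  zero_mem' := by
    intro c c' p _
    have h : ∀ q : Fin 2 → ℂ, evalVec q (0 : Fin 2 → ChartRing) = 0 := by
      intro q; funext k; simp [evalVec]
    simp [h]
  add_mem' := by
    intro s t hs ht c c' p hp
    have h : ∀ (q : Fin 2 → ℂ) (u v : Fin 2 → ChartRing),
        evalVec q (u + v) = evalVec q u + evalVec q v := by
      intro q u v; funext k; simp [evalVec]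
    rw [Pi.add_apply, Pi.add_apply, h, h, hs c c' p hp, ht c c' p hp, map_add, smul_add]
  smul_mem' := by
    intro z s hs c c' p hp
    have h : ∀ (q : Fin 2 → ℂ) (u : Fin 2 → ChartRing), evalVec q (z • u) = z • evalVec q u := by
      intro q u; funext k; simp [evalVec]
    rw [Pi.smul_apply, Pi.smul_apply, h, h, hs c c' p hp, map_smul, smul_comm]

/-- Global endomorphisms of the tangent bundle of `S_δ`: a `2 × 2` matrix of regular functions on
each chart; on overlaps the matrices are conjugate under the derivative of the change of
coordinates. -/
def endT (δ : ℕ) : Subalgebra ℂ (Chart → Matrix (Fin 2) (Fin 2) ChartRing) where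
  carrier := {M | ∀ c c' : Chart, ∀ p ∈ overlap c c', ∀ v : Fin 2 → ℂ,
    (evalMat (trans δ c c' p) (M c')).mulVec (fderiv ℂ (trans δ c c') p v) =
      fderiv ℂ (trans δ c c') p ((evalMat p (M c)).mulVec v)}
  mul_mem' := by
    intro M N hM hN c c' p hp v
    have h : ∀ (q : Fin 2 → ℂ) (A B : Matrix (Fin 2) (Fin 2) ChartRing),
        evalMat q (A * B) = evalMat q A * evalMat q B := by
      intro q A B; exact Matrix.map_mul
    rw [Pi.mul_apply, Pi.mul_apply, h, h, ← Matrix.mulVec_mulVec, ← Matrix.mulVec_mulVec,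
      hN c c' p hp, hM c c' p hp]
  add_mem' := by
    intro M N hM hN c c' p hp v
    have h : ∀ (q : Fin 2 → ℂ) (A B : Matrix (Fin 2) (Fin 2) ChartRing),
        evalMat q (A + B) = evalMat q A + evalMat q B := by
      intro q A B; ext k l; simp [evalMat]
    rw [Pi.add_apply, Pi.add_apply, h, h, Matrix.add_mulVec, Matrix.add_mulVec,
      hN c c' p hp, hM c c' p hp, map_add]
  algebraMap_mem' := by
    intro z c c' p hp v
    have h : ∀ (q : Fin 2 → ℂ) (e : Chart) (w : Fin 2 → ℂ),
        (evalMat q ((algebraMap ℂ (Chart → Matrix (Fin 2) (Fin 2) ChartRing)) z e)).mulVec w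
          = z • w := by
      intro q e w
      have h1 : evalMat q ((algebraMap ℂ (Chart → Matrix (Fin 2) (Fin 2) ChartRing)) z e)
          = z • (1 : Matrix (Fin 2) (Fin 2) ℂ) := by
        ext k l
        by_cases hkl : k = l
        · simp [evalMat, Pi.algebraMap_apply, Matrix.algebraMap_matrix_apply, hkl,
            MvPolynomial.algebraMap_eq]
        · simp [evalMat, Pi.algebraMap_apply, Matrix.algebraMap_matrix_apply, hkl]
      rw [h1, Matrix.smul_mulVec, Matrix.one_mulVec]
    rw [h, h, map_smul]

/-- The section `Φ(s)`. -/
def applyEnd {δ : ℕ} {d₁ d₂ : ℤ} (Φ : endT δ) (s : sections δ d₁ d₂) : sections δ d₁ d₂ :=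
  ⟨fun c => (Φ.1 c).mulVec (s.1 c), by
    intro c c' p hp
    rw [evalVec_mulVec, evalVec_mulVec, s.2 c c' p hp, Matrix.mulVec_smul, Φ.2 c c' p hp]⟩

/-- `[s] = [t]` in the projective space of sections, i.e. `s` and `t` are non-zero and define the
same foliation. -/
def SameFoliation {δ : ℕ} {d₁ d₂ : ℤ} (s t : sections δ d₁ d₂) : Prop :=
  ∃ (hs : s ≠ 0) (ht : t ≠ 0), Projectivization.mk ℂ s hs = Projectivization.mk ℂ t ht

/-- The ideal sheaf of the singular scheme `Z_s`, given by its ideal in the ring of each chart: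
the ideal generated by the two coefficients of the vector field. -/
def singIdeal {δ : ℕ} {d₁ d₂ : ℤ} (s : sections δ d₁ d₂) (c : Chart) : Ideal ChartRing :=
  Ideal.span (Set.range (s.1 c))

/-- `Z_s ⊆ Z_t` as closed subschemes: inclusion of ideal sheaves `I_{Z_t} ⊆ I_{Z_s}`. -/
def SingSubscheme {δ : ℕ} {d₁ d₂ : ℤ} (s t : sections δ d₁ d₂) : Prop :=
  ∀ c : Chart, singIdeal t c ≤ singIdeal s c

/-- `Z_s = Z_t` as closed subschemes. -/
def SingEq {δ : ℕ} {d₁ d₂ : ℤ} (s t : sections δ d₁ d₂) : Prop :=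
  ∀ c : Chart, singIdeal s c = singIdeal t c

/-- The dimension of the singular scheme `Z_s`: the largest of the dimensions of its four affine
open pieces (it is `⊥` if `Z_s` is empty). -/
def singDim {δ : ℕ} {d₁ d₂ : ℤ} (s : sections δ d₁ d₂) : WithBot ℕ∞ :=
  ⨆ c : Chart, ringKrullDim (ChartRing ⧸ singIdeal s c)

/-- The bi-degrees of `X₀, X₁, Y₀, Y₁`. -/
def weight (δ : ℕ) : Fin 4 → ℤ × ℤ := ![(1, 0), (1, 0), (0, 1), (-(δ : ℤ), 1)]

/-- Bi-homogeneous polynomials of bi-degree `(d₁, d₂)` (zero included). -/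
def BiHomogeneous (δ : ℕ) (H : CoxRing) (d₁ d₂ : ℤ) : Prop :=
  IsWeightedHomogeneous (weight δ) H (d₁, d₂)

/-- Affine vector fields `V₀ ∂/∂X₀ + V₁ ∂/∂X₁ + W₀ ∂/∂Y₀ + W₁ ∂/∂Y₁` with `V₀, V₁` of bi-degree
`(d₁ + 1, d₂)`, `W₀` of bi-degree `(d₁, d₂ + 1)` and `W₁` of bi-degree `(d₁ - δ, d₂ + 1)`. -/
structure AffineVectorField (δ : ℕ) (d₁ d₂ : ℤ) where
  V₀ : CoxRing
  V₁ : CoxRing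
  W₀ : CoxRing
  W₁ : CoxRing
  hV₀ : BiHomogeneous δ V₀ (d₁ + 1) d₂
  hV₁ : BiHomogeneous δ V₁ (d₁ + 1) d₂
  hW₀ : BiHomogeneous δ W₀ d₁ (d₂ + 1)
  hW₁ : BiHomogeneous δ W₁ (d₁ - δ) (d₂ + 1)

/-- The section `s` is represented by the affine vector field `X`: in each chart, `s` is the image
of `X` under the derivative of the quotient map. -/
def Represents {δ : ℕ} {d₁ d₂ : ℤ} (X : AffineVectorField δ d₁ d₂) (s : sections δ d₁ d₂) : Prop :=
  ∀ (c : Chart) (p : Fin 2 → ℂ), evalVec p (s.1 c) =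
    fderiv ℂ (coord δ c) (lift c p) (evalVec (lift c p) ![X.V₀, X.V₁, X.W₀, X.W₁])

/-- The endomorphism `Φ` is associated with the `4 × 4` matrix `A`, which acts on affine vector
fields: `Φ ∘ dπ = dπ ∘ A` in each chart, where `π` is the quotient map. -/
def HasMatrix {δ : ℕ} (Φ : endT δ) (A : Matrix (Fin 4) (Fin 4) CoxRing) : Prop :=
  ∀ (c : Chart) (p : Fin 2 → ℂ) (v : Fin 4 → ℂ),
    (evalMat p (Φ.1 c)).mulVec (fderiv ℂ (coord δ c) (lift c p) v) =
      fderiv ℂ (coord δ c) (lift c p) ((evalMat (lift c p) A).mulVec v)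

/-- The matrix `A(a, d)`, for `δ = 0`. -/
def matrixZero (a d : ℂ) : Matrix (Fin 4) (Fin 4) CoxRing :=
  Matrix.diagonal ![C a, C a, C d, C d]

/-- The matrix `A(a, Q)`, for `δ ≥ 2`, where `Q` is a polynomial in `X₀, X₁`. -/
def matrixTwo (a : ℂ) (Q : MvPolynomial (Fin 2) ℂ) : Matrix (Fin 4) (Fin 4) CoxRing :=
  !![C a, 0, 0, 0;
     0, C a, 0, 0;
     X 1 * X 3 * rename xIdx Q, -(X 0 * X 3 * rename xIdx Q), C a, 0;
     0, 0, 0, C a]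

end Hirzebruch

end

noncomputable section

namespace Hirzebruch

/-! ### Polynomials in one and two variables -/

/-! The surface is a bundle of projective lines over a projective line, with x on the base and y on
the fibre of each chart, and Φ is a 2 × 2 matrix in each chart. Regularity at both ends of a
projective line is used in one form: if x^m f(x) = x^n g(1/x) for polynomials f and g, then f has no
coefficient of index j with j + m > n. Applied along the fibre and along the base, this determines Φ
(`end_eq`). The x-component of Φ(∂/∂y) vanishes, the diagonal entries are constants a and d, δ(a −
d) = 0, and the lower left entry in the chart (0, 0) is y² Q(1, x), where Q is zero if δ < 2 and
homogeneous of degree δ − 2 otherwise (`exists_shear`).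

Write s = (s₀, s₁) in a chart and let g be the lower left entry. Then Φ(s) = (a s₀, g s₀ + d s₁),
and the rest is algebra. Φ is invertible exactly when ad ≠ 0. Up to sign, s₀ is X₀V₁ − X₁V₀
restricted to the chart, and for δ = 0 so is s₁ for Y₀W₁ − Y₁W₀ (`Represents.fst`,
`Represents.snd`). These are bi-homogeneous, so they vanish on one chart only if they vanish
identically (`BiHomogeneous.eq_zero`). Comparing coefficients of Φ(s) and b s then gives the
criteria for [Φ(s)] = [s].

If Φ is not invertible, one coefficient of Φ(s) is zero in every chart, so the singular ideal is
principal. A nonzero Φ(s) then has a singular scheme of dimension one as soon as the generator is a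
non-unit in some chart (`singDim_eq_one`). For δ = 0 the generator has positive degree in one pair
of variables; for δ ≥ 2 it has the factor y² in the chart (0, 0). -/

theorem coeff_eq_zero_of_inversion {f g : Polynomial ℂ} {m n : ℕ}
    (h : ∀ x : ℂ, x ≠ 0 → x ^ m * f.eval x = x ^ n * g.eval x⁻¹) {j : ℕ} (hj : n < j + m) :
    f.coeff j = 0 := by
  -- Multiplying by x^(deg g) clears the negative powers. The right side then has degree at most n +
  -- deg g, which bounds the exponents on the left.
  have key : Polynomial.X ^ (m + g.natDegree) * f = Polynomial.X ^ n * g.reverse := by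
    refine Polynomial.eq_of_infinite_eval_eq _ _
      ((Set.finite_singleton (0 : ℂ)).infinite_compl.mono ?_)
    intro x hx
    have hx : x ≠ 0 := hx
    let _ : Invertible x := invertibleOfNonzero hx
    have h1 := Polynomial.eval₂_reverse_mul_pow (RingHom.id ℂ) x⁻¹ g
    let _ : Invertible x⁻¹ := invertibleOfNonzero (inv_ne_zero hx)
    have h2 := Polynomial.eval₂_reverse_mul_pow (RingHom.id ℂ) x⁻¹ g
    simp only [invOf_eq_inv, inv_inv, Polynomial.eval₂_id] at h2
    simp only [Set.mem_ofPred_eq, Polynomial.eval_mul, Polynomial.eval_pow, Polynomial.eval_X]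
    rw [pow_add, mul_right_comm, h x hx, ← h2, inv_pow]
    field_simp
  have h1 := congrArg (fun q => Polynomial.coeff q (j + m + g.natDegree)) key
  simp only [show j + m + g.natDegree = j + (m + g.natDegree) by ring,
    Polynomial.coeff_X_pow_mul] at h1
  rw [h1, show j + (m + g.natDegree) = (j + m - n + g.natDegree) + n by omega,
    Polynomial.coeff_X_pow_mul]
  apply Polynomial.coeff_eq_zero_of_natDegree_lt
  have := Polynomial.reverse_natDegree_le g
  omega

theorem vec_two_eta (p : Fin 2 → ℂ) : ![p 0, p 1] = p := by
  funext k
  fin_cases k <;> rfl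

theorem chartRing_ext {f g : ChartRing} (h : ∀ x y : ℂ, eval ![x, y] f = eval ![x, y] g) :
    f = g :=
  MvPolynomial.funext fun p => by rw [← vec_two_eta p, h]

/-- Coordinate changes give identities only where they are defined. Multiplication by xy extends
such an identity to the whole plane, and xy can be cancelled. -/
theorem chartRing_ext_torus {f g : ChartRing}
    (h : ∀ x y : ℂ, x ≠ 0 → y ≠ 0 → eval ![x, y] f = eval ![x, y] g) : f = g := by
  have h1 : (X 0 * X 1 : ChartRing) * f = X 0 * X 1 * g := by
    refine chartRing_ext fun x y => ?_
    by_cases hx : x = 0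
    · simp [hx]
    by_cases hy : y = 0
    · simp [hy]
    simp [h x y hx hy]
  exact mul_left_cancel₀ (mul_ne_zero (X_ne_zero 0) (X_ne_zero 1)) h1

/-- The ring `ℂ[x, y]` as `ℂ[x][y]`. -/
def toBivariate : ChartRing →+* Polynomial (Polynomial ℂ) :=
  eval₂Hom (Polynomial.C.comp Polynomial.C) ![Polynomial.C Polynomial.X, Polynomial.X]

/-- The polynomial `f (x, ·)`. -/
def slice (f : ChartRing) (x : ℂ) : Polynomial ℂ := (toBivariate f).map (Polynomial.evalRingHom x)

theorem eval_slice (f : ChartRing) (x y : ℂ) : (slice f x).eval y = eval ![x, y] f := by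
  have : ((Polynomial.evalRingHom y).comp
      (Polynomial.mapRingHom (Polynomial.evalRingHom x))).comp toBivariate = eval ![x, y] := by
    ext i
    · simp [toBivariate]
    · fin_cases i <;> simp [toBivariate]
  exact congrArg (fun φ : ChartRing →+* ℂ => φ f) this

theorem coeff_slice (f : ChartRing) (x : ℂ) (k : ℕ) :
    (slice f x).coeff k = ((toBivariate f).coeff k).eval x := by
  simp [slice]

theorem coeff_slice_eq_zero {f g : ChartRing} {m n : ℕ} {x : ℂ}
    (h : ∀ y : ℂ, y ≠ 0 → y ^ m * eval ![x, y] f = y ^ n * eval ![x, y⁻¹] g) {j : ℕ}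
    (hj : n < j + m) : (slice f x).coeff j = 0 :=
  coeff_eq_zero_of_inversion (f := slice f x) (g := slice g x)
    (fun y hy => by rw [eval_slice, eval_slice, h y hy]) hj

theorem eval_eq_of_coeff_slice {f : ChartRing} {x : ℂ}
    (h : ∀ j, 0 < j → (slice f x).coeff j = 0) (y : ℂ) : eval ![x, y] f = eval ![x, 0] f := by
  have h1 : slice f x = Polynomial.C ((slice f x).coeff 0) := by
    ext j
    rcases Nat.eq_zero_or_pos j with rfl | hj
    · simp
    · rw [h j hj, Polynomial.coeff_C_of_ne_zero hj.ne']
  rw [← eval_slice, ← eval_slice, h1]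
  simp

/-! ### Dimension of a plane curve -/

theorem ringKrullDim_quotient_span_singleton_le {f : ChartRing} (hf : f ≠ 0) :
    ringKrullDim (ChartRing ⧸ Ideal.span {f}) ≤ 1 := by
  have h1 := ringKrullDim_quotient_succ_le_of_nonZeroDivisor (mem_nonZeroDivisors_of_ne_zero hf)
  have h2 : ringKrullDim ChartRing = 2 := by
    rw [MvPolynomial.ringKrullDim_of_isNoetherianRing, ringKrullDim_eq_zero_of_field]
    simp
  rw [h2] at h1
  generalize ringKrullDim (ChartRing ⧸ Ideal.span {f}) = d at h1
  induction d with
  | bot => exact bot_le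
  | coe d =>
    have h3 : d + 1 ≤ 1 + 1 := by
      rw [one_add_one_eq_two]
      exact WithBot.coe_le_coe.1 h1
    have h4 : d ≤ 1 := (ENat.add_le_add_iff_right ENat.one_ne_top).1 h3
    exact_mod_cast h4

/-- If the dimension were zero, an irreducible factor g of f would generate a maximal ideal, hence
by the Nullstellensatz the ideal of a point p. Then g would divide both x − p₀ and y − p₁, and so x
− p₀ would divide y − p₁. -/
theorem one_le_ringKrullDim_quotient_span_singleton {f : ChartRing} (hf : f ≠ 0)
    (hu : ¬ IsUnit f) : 1 ≤ ringKrullDim (ChartRing ⧸ Ideal.span {f}) := by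
  obtain ⟨g, hg, hgf⟩ := WfDvdMonoid.exists_irreducible_factor hu hf
  have hle : Ideal.span {f} ≤ Ideal.span {g} := Ideal.span_singleton_le_span_singleton.2 hgf
  refine le_trans ?_ (ringKrullDim_le_of_surjective (Ideal.Quotient.factor hle)
    (Ideal.Quotient.factor_surjective hle))
  have hprime : (Ideal.span {g}).IsPrime :=
    (Ideal.span_singleton_prime hg.ne_zero).2 hg.prime
  by_contra hlt
  have hle0 : ringKrullDim (ChartRing ⧸ Ideal.span {g}) ≤ 0 := by
    generalize ringKrullDim (ChartRing ⧸ Ideal.span {g}) = d at hlt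
    induction d with
    | bot => exact bot_le
    | coe d =>
      have h4 : d < 1 := by
        rw [not_le] at hlt
        exact_mod_cast hlt
      rw [Order.lt_one_iff.1 h4]
      rfl
  have : Ring.KrullDimLE 0 (ChartRing ⧸ Ideal.span {g}) := Order.krullDimLE_iff _ _ |>.2 hle0
  have hmax : (Ideal.span {g}).IsMaximal :=
    Ideal.Quotient.maximal_of_isField _ (Ring.KrullDimLE.isField_of_isDomain)
  obtain ⟨p, hp⟩ := isMaximal_iff_eq_vanishingIdeal_singleton.1 hmax
  have hdvd : ∀ i, g ∣ X i - C (p i) := fun i => by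
    rw [← Ideal.mem_span_singleton, hp, mem_vanishingIdeal_singleton_iff]
    simp
  have hirr : Irreducible (X 0 - C (p 0) : ChartRing) := by
    have h1 := irreducible_mul_X_add (1 : ChartRing) (C (-p 0)) 0 one_ne_zero (by simp)
      (by simp) isRelPrime_one_left
    simpa [sub_eq_add_neg] using h1
  have h1 : (X 0 - C (p 0) : ChartRing) ∣ X 1 - C (p 1) :=
    ((hg.dvd_symm hirr (hdvd 0))).trans (hdvd 1)
  -- At this point the divisor is 0 and the dividend is 1.
  have h2 := map_dvd (eval ![p 0, p 1 + 1]) h1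
  simp at h2

/-! ### Derivatives of the quotient map and of the changes of coordinates -/

theorem hasFDerivAt_quotient {n : ℕ} {f g : (Fin n → ℂ) → ℂ} {f' g' : (Fin n → ℂ) →L[ℂ] ℂ}
    {P : Fin n → ℂ} (hf : HasFDerivAt f f' P) (hg : HasFDerivAt g g' P) (h : g P ≠ 0) :
    HasFDerivAt (fun Q => f Q / g Q) ((g P)⁻¹ • f' - (f P / g P ^ 2) • g') P := by
  have h1 := hf.mul ((hasDerivAt_inv h).comp_hasFDerivAt P hg)
  convert! h1 using 1
  ext v
  simp
  field_simp
  ring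

theorem hasFDerivAt_pow_mul {n : ℕ} (δ : ℕ) (i j : Fin n) (P : Fin n → ℂ) :
    HasFDerivAt (fun Q : Fin n → ℂ => Q i ^ δ * Q j)
      (P i ^ δ • (ContinuousLinearMap.proj j : (Fin n → ℂ) →L[ℂ] ℂ) +
        (δ * P i ^ (δ - 1) * P j) • (ContinuousLinearMap.proj i : (Fin n → ℂ) →L[ℂ] ℂ)) P := by
  have h1 := ((hasFDerivAt_apply (𝕜 := ℂ) i P).pow δ).mul (hasFDerivAt_apply (𝕜 := ℂ) j P)
  convert! h1 using 1
  ext v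
  simp
  ring

theorem hasFDerivAt_vec_two {n : ℕ} {f g : (Fin n → ℂ) → ℂ} {f' g' : (Fin n → ℂ) →L[ℂ] ℂ}
    {P : Fin n → ℂ} (hf : HasFDerivAt f f' P) (hg : HasFDerivAt g g' P) :
    HasFDerivAt (fun Q => ![f Q, g Q]) (ContinuousLinearMap.pi ![f', g']) P :=
  hasFDerivAt_pi'' fun k => by
    fin_cases k
    · exact hf
    · exact hg

theorem hasFDerivAt_coord (δ : ℕ) (c : Chart) {P : Fin 4 → ℂ} (hx : P (xIdx c.1) ≠ 0)
    (hy : P (yIdx c.2) ≠ 0) : ∃ F : (Fin 4 → ℂ) →L[ℂ] (Fin 2 → ℂ), HasFDerivAt (coord δ c) F P ∧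
      ∀ v, F v = ![v (xIdx c.1.rev) / P (xIdx c.1) -
          P (xIdx c.1.rev) * v (xIdx c.1) / P (xIdx c.1) ^ 2,
        if c.2 = 0 then
          (P (xIdx c.1) ^ δ * v 3 + δ * P (xIdx c.1) ^ (δ - 1) * P 3 * v (xIdx c.1)) / P 2 -
            P (xIdx c.1) ^ δ * P 3 * v 2 / P 2 ^ 2
        else v 2 / (P (xIdx c.1) ^ δ * P 3) -
          P 2 * (P (xIdx c.1) ^ δ * v 3 + δ * P (xIdx c.1) ^ (δ - 1) * P 3 * v (xIdx c.1)) /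
            (P (xIdx c.1) ^ δ * P 3) ^ 2] := by
  have h0 := hasFDerivAt_quotient (hasFDerivAt_apply (𝕜 := ℂ) (xIdx c.1.rev) P)
    (hasFDerivAt_apply (𝕜 := ℂ) (xIdx c.1) P) hx
  have h2 := hasFDerivAt_apply (𝕜 := ℂ) (2 : Fin 4) P
  have h3 := hasFDerivAt_pow_mul δ (xIdx c.1) 3 P
  obtain ⟨i, j⟩ := c
  fin_cases j
  · have h1 := hasFDerivAt_quotient h3 h2 hy
    refine ⟨_, hasFDerivAt_vec_two h0 h1, fun v => ?_⟩
    funext k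
    fin_cases k <;> simp <;> ring
  · have h1 := hasFDerivAt_quotient h2 h3 (mul_ne_zero (pow_ne_zero δ hx) hy)
    refine ⟨_, hasFDerivAt_vec_two h0 h1, fun v => ?_⟩
    funext k
    fin_cases k <;> simp <;> ring

theorem hasFDerivAt_lift (c : Chart) (p : Fin 2 → ℂ) :
    ∃ F : (Fin 2 → ℂ) →L[ℂ] (Fin 4 → ℂ), HasFDerivAt (lift c) F p ∧
      ∀ v, F v = ![if c.1 = 0 then 0 else v 0, if c.1 = 0 then v 0 else 0,
        if c.2 = 0 then 0 else v 1, if c.2 = 0 then v 1 else 0] := by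
  have h0 := hasFDerivAt_apply (𝕜 := ℂ) (0 : Fin 2) p
  have h1 := hasFDerivAt_apply (𝕜 := ℂ) (1 : Fin 2) p
  have hc := hasFDerivAt_const (𝕜 := ℂ) (1 : ℂ) p
  refine ⟨ContinuousLinearMap.pi ![if c.1 = 0 then 0 else .proj 0, if c.1 = 0 then .proj 0 else 0,
        if c.2 = 0 then 0 else .proj 1, if c.2 = 0 then .proj 1 else 0],
    hasFDerivAt_pi'' fun k => ?_, fun v => ?_⟩
  · obtain ⟨i, j⟩ := c
    fin_cases i <;> fin_cases j <;> fin_cases k <;> first | exact h0 | exact h1 | exact hc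
  · obtain ⟨i, j⟩ := c
    fin_cases i <;> fin_cases j <;> funext k <;> fin_cases k <;> simp

/-- The derivative of the quotient map, read in the four charts. -/
theorem fderiv_coord_lift (δ : ℕ) (c : Chart) (x y : ℂ) (v : Fin 4 → ℂ) :
    fderiv ℂ (coord δ c) (lift c ![x, y]) v =
      ![v (xIdx c.1.rev) - x * v (xIdx c.1),
        if c.2 = 0 then v 3 + δ * y * v (xIdx c.1) - y * v 2
        else v 2 - δ * y * v (xIdx c.1) - y * v 3] := by
  obtain ⟨i, j⟩ := c
  obtain ⟨F, hF, hF'⟩ := hasFDerivAt_coord δ (i, j) (P := lift (i, j) ![x, y])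
    (by fin_cases i <;> simp [lift, xIdx]) (by fin_cases j <;> simp [lift, yIdx])
  rw [hF.fderiv, hF']
  fin_cases i <;> fin_cases j <;> funext k <;> fin_cases k <;> simp [lift, xIdx] <;> ring

theorem fderiv_trans (δ : ℕ) {c c' : Chart} {p : Fin 2 → ℂ} (hp : p ∈ overlap c c')
    (v : Fin 2 → ℂ) : fderiv ℂ (trans δ c c') p v =
      fderiv ℂ (coord δ c') (lift c p) (fderiv ℂ (lift c) p v) := by
  obtain ⟨F, hF, -⟩ := hasFDerivAt_lift c p
  obtain ⟨G, hG, -⟩ := hasFDerivAt_coord δ c' (P := lift c p) hp.1 hp.2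
  have := hG.comp p hF
  rw [hF.fderiv, hG.fderiv, show trans δ c c' = coord δ c' ∘ lift c from rfl, this.fderiv]
  rfl

theorem fderiv_trans_vertical (δ : ℕ) (i : Fin 2) (x : ℂ) {y : ℂ} (hy : y ≠ 0) (v : Fin 2 → ℂ) :
    fderiv ℂ (trans δ (i, 0) (i, 1)) ![x, y] v = ![v 0, -v 1 / y ^ 2] := by
  have hp : ![x, y] ∈ overlap (i, 0) (i, 1) := by
    fin_cases i <;> simp [overlap, lift, xIdx, yIdx, hy]
  obtain ⟨F, hF, hF'⟩ := hasFDerivAt_lift (i, 0) ![x, y]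
  obtain ⟨G, hG, hG'⟩ := hasFDerivAt_coord δ (i, 1) (P := lift (i, 0) ![x, y]) hp.1 hp.2
  rw [fderiv_trans δ hp, hF.fderiv, hF', hG.fderiv, hG']
  fin_cases i <;> funext k <;> fin_cases k <;> simp [lift, xIdx] <;> field_simp

theorem fderiv_trans_horizontal (δ : ℕ) {x : ℂ} (hx : x ≠ 0) (y : ℂ) (v : Fin 2 → ℂ) :
    fderiv ℂ (trans δ (0, 0) (1, 0)) ![x, y] v =
      ![-v 0 / x ^ 2, x ^ δ * v 1 + δ * x ^ (δ - 1) * y * v 0] := by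
  have hp : ![x, y] ∈ overlap (0, 0) (1, 0) := by
    simp [overlap, lift, xIdx, yIdx, hx]
  obtain ⟨F, hF, hF'⟩ := hasFDerivAt_lift (0, 0) ![x, y]
  obtain ⟨G, hG, hG'⟩ := hasFDerivAt_coord δ (1, 0) (P := lift (0, 0) ![x, y]) hp.1 hp.2
  rw [fderiv_trans δ hp, hF.fderiv, hF', hG.fderiv, hG']
  funext k
  fin_cases k <;> simp [lift, xIdx, neg_div]

theorem trans_vertical (δ : ℕ) (i : Fin 2) (x y : ℂ) :
    trans δ (i, 0) (i, 1) ![x, y] = ![x, y⁻¹] := by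
  funext k
  fin_cases i <;> fin_cases k <;> simp [trans, coord, lift, xIdx]

theorem trans_horizontal (δ : ℕ) (x y : ℂ) :
    trans δ (0, 0) (1, 0) ![x, y] = ![x⁻¹, x ^ δ * y] := by
  funext k
  fin_cases k <;> simp [trans, coord, lift, xIdx]

/-! ### Global endomorphisms of the tangent bundle -/

theorem coeff_zero_slice (f : ChartRing) (x : ℂ) : (slice f x).coeff 0 = eval ![x, 0] f := by
  rw [← eval_slice, Polynomial.coeff_zero_eq_eval_zero]

/-- The coordinate change y ↦ 1/y has derivative diag(1, −y⁻²), and conjugation by it rescales only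
the off-diagonal entries. -/
theorem end_vertical {δ : ℕ} (Φ : endT δ) (i : Fin 2) (x : ℂ) {y : ℂ} (hy : y ≠ 0) :
    eval ![x, y⁻¹] (Φ.1 (i, 1) 0 0) = eval ![x, y] (Φ.1 (i, 0) 0 0) ∧
    eval ![x, y⁻¹] (Φ.1 (i, 1) 0 1) = -y ^ 2 * eval ![x, y] (Φ.1 (i, 0) 0 1) ∧
    y ^ 2 * eval ![x, y⁻¹] (Φ.1 (i, 1) 1 0) = -eval ![x, y] (Φ.1 (i, 0) 1 0) ∧
    eval ![x, y⁻¹] (Φ.1 (i, 1) 1 1) = eval ![x, y] (Φ.1 (i, 0) 1 1) := by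
  have hp : ![x, y] ∈ overlap (i, 0) (i, 1) := by
    fin_cases i <;> simp [overlap, lift, xIdx, yIdx, hy]
  have h0 := Φ.2 (i, 0) (i, 1) ![x, y] hp ![1, 0]
  have h1 := Φ.2 (i, 0) (i, 1) ![x, y] hp ![0, 1]
  rw [fderiv_trans_vertical δ i x hy, fderiv_trans_vertical δ i x hy, trans_vertical] at h0 h1
  have h00 := congrFun h0 0
  have h01 := congrFun h0 1
  have h10 := congrFun h1 0
  have h11 := congrFun h1 1
  simp [Matrix.mulVec, dotProduct, Fin.sum_univ_two, evalMat] at h00 h01 h10 h11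
  field_simp at h01 h10 h11
  simp only [one_div] at h01 h10 h11
  refine ⟨h00, ?_, ?_, ?_⟩
  · linear_combination -h10
  · linear_combination h01
  · linear_combination -h11

/-- The derivative is lower triangular with diagonal −x⁻², x^δ and corner δ x^(δ−1) y. This corner
brings the difference of the diagonal entries into the formula for the lower left one, which later
forces a = d when δ ≠ 0. -/
theorem end_horizontal {δ : ℕ} (Φ : endT δ) (h0 : Φ.1 (0, 0) 0 1 = 0) (h1 : Φ.1 (1, 0) 0 1 = 0)
    {x : ℂ} (hx : x ≠ 0) (y : ℂ) :
    eval ![x⁻¹, x ^ δ * y] (Φ.1 (1, 0) 0 0) = eval ![x, y] (Φ.1 (0, 0) 0 0) ∧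
    eval ![x⁻¹, x ^ δ * y] (Φ.1 (1, 0) 1 1) = eval ![x, y] (Φ.1 (0, 0) 1 1) ∧
    eval ![x⁻¹, x ^ δ * y] (Φ.1 (1, 0) 1 0) =
      -(δ * x ^ (δ + 1) * y * (eval ![x, y] (Φ.1 (0, 0) 0 0) - eval ![x, y] (Φ.1 (0, 0) 1 1))
        + x ^ (δ + 2) * eval ![x, y] (Φ.1 (0, 0) 1 0)) := by
  have hp : ![x, y] ∈ overlap (0, 0) (1, 0) := by
    simp [overlap, lift, xIdx, yIdx, hx]
  have e0 := Φ.2 (0, 0) (1, 0) ![x, y] hp ![1, 0]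
  have e1 := Φ.2 (0, 0) (1, 0) ![x, y] hp ![0, 1]
  rw [fderiv_trans_horizontal δ hx, fderiv_trans_horizontal δ hx, trans_horizontal] at e0 e1
  have h00 := congrFun e0 0
  have h01 := congrFun e0 1
  have h11 := congrFun e1 1
  simp [Matrix.mulVec, dotProduct, Fin.sum_univ_two, evalMat, h0, h1] at h00 h01 h11
  -- The truncated exponent δ − 1 is harmless: for δ = 0 both sides carry the factor 0.
  have hδ : (δ : ℂ) * x ^ (δ + 1) = δ * x ^ (δ - 1) * x ^ 2 := by
    rcases δ with _ | δ
    · simp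
    · simp; ring
  have h11' : eval ![x⁻¹, x ^ δ * y] (Φ.1 (1, 0) 1 1) = eval ![x, y] (Φ.1 (0, 0) 1 1) :=
    mul_right_cancel₀ (pow_ne_zero δ hx) (h11.trans (mul_comm _ _))
  refine ⟨?_, h11', ?_⟩
  · field_simp at h00
    simp only [one_div] at h00
    linear_combination -h00
  · rw [h11'] at h01
    field_simp at h01
    simp only [one_div] at h01
    rw [hδ]
    linear_combination -h01

/-- On a fibre this entry is a section of a line bundle of degree −2: y² times a polynomial in y
equals a polynomial in 1/y. -/
theorem end_upper_eq_zero {δ : ℕ} (Φ : endT δ) (c : Chart) : Φ.1 c 0 1 = 0 := by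
  have key (i : Fin 2) : Φ.1 (i, 0) 0 1 = 0 := by
    refine chartRing_ext fun x y => ?_
    have h : slice (Φ.1 (i, 0) 0 1) x = 0 := by
      ext j
      refine coeff_slice_eq_zero (g := -Φ.1 (i, 1) 0 1) (m := 2) (n := 0) (fun y hy => ?_)
        (by omega)
      rw [map_neg, (end_vertical Φ i x hy).2.1]
      ring
    rw [← eval_slice, h]
    simp
  obtain ⟨i, j⟩ := c
  fin_cases j
  · exact key i
  · refine chartRing_ext_torus fun x y _ hy => ?_
    have h := (end_vertical Φ i x (inv_ne_zero hy)).2.1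
    simpa [key i] using h

/-- Functions on the four charts that agree on the overlaps are constant. -/
theorem exists_eq_C {δ : ℕ} {f : Chart → ChartRing}
    (hV : ∀ (i : Fin 2) (x y : ℂ), y ≠ 0 → eval ![x, y⁻¹] (f (i, 1)) = eval ![x, y] (f (i, 0)))
    (hH : ∀ x y : ℂ, x ≠ 0 → eval ![x⁻¹, x ^ δ * y] (f (1, 0)) = eval ![x, y] (f (0, 0))) :
    ∃ a : ℂ, ∀ c, f c = C a := by
  -- First along the fibres: a polynomial in y that is also a polynomial in 1/y is constant. The
  -- same argument in x, on the curve y = 0, gives `hc`.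
  have h0 (i : Fin 2) (x y : ℂ) : eval ![x, y] (f (i, 0)) = eval ![x, 0] (f (i, 0)) := by
    refine eval_eq_of_coeff_slice (fun j hj => ?_) y
    refine coeff_slice_eq_zero (g := f (i, 1)) (m := 0) (n := 0) (fun y hy => ?_) (by omega)
    rw [hV i x y hy]
  have hc (x : ℂ) : eval ![x, 0] (f (0, 0)) = ((toBivariate (f (0, 0))).coeff 0).coeff 0 := by
    have h : (toBivariate (f (0, 0))).coeff 0 =
        Polynomial.C (((toBivariate (f (0, 0))).coeff 0).coeff 0) := by
      ext j
      rcases Nat.eq_zero_or_pos j with rfl | hj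
      · simp
      rw [Polynomial.coeff_C_of_ne_zero hj.ne']
      refine coeff_eq_zero_of_inversion (g := (toBivariate (f (1, 0))).coeff 0) (m := 0) (n := 0)
        (fun x hx => ?_) (by omega)
      rw [← coeff_slice, ← coeff_slice, coeff_zero_slice, coeff_zero_slice, ← hH x 0 hx, mul_zero]
    rw [← coeff_zero_slice, coeff_slice, h]
    simp
  have h10 (i : Fin 2) : f (i, 0) = C (((toBivariate (f (0, 0))).coeff 0).coeff 0) := by
    fin_cases i
    · refine chartRing_ext fun x y => ?_
      simpa [hc] using h0 0 x y
    · refine chartRing_ext_torus fun x y hx _ => ?_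
      have h := hH x⁻¹ 0 (inv_ne_zero hx)
      rw [hc, inv_inv, mul_zero] at h
      simpa [h] using h0 1 x y
  refine ⟨((toBivariate (f (0, 0))).coeff 0).coeff 0, fun c => ?_⟩
  obtain ⟨i, j⟩ := c
  fin_cases j
  · exact h10 i
  · refine chartRing_ext_torus fun x y _ hy => ?_
    have h := hV i x y⁻¹ (inv_ne_zero hy)
    rw [inv_inv, h10] at h
    simpa using h

/-- The lower left coefficient, in the chart `c`, of the endomorphism with matrix `A(a, Q)`. -/
def shear (Q : MvPolynomial (Fin 2) ℂ) (c : Chart) : ChartRing :=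
  (if c.1 = 0 then 1 else -1) * (if c.2 = 0 then X 1 ^ 2 else -1) *
    aeval (if c.1 = 0 then ![1, X 0] else ![X 0, 1] : Fin 2 → ChartRing) Q

theorem eval_shear (Q : MvPolynomial (Fin 2) ℂ) (c : Chart) (x y : ℂ) :
    eval ![x, y] (shear Q c) = (if c.1 = 0 then 1 else -1) * (if c.2 = 0 then y ^ 2 else -1) *
      eval (if c.1 = 0 then ![1, x] else ![x, 1]) Q := by
  have h (u : Fin 2 → ChartRing) (w : Fin 2 → ℂ) (hu : ∀ i, eval ![x, y] (u i) = w i) :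
      eval ![x, y] (aeval u Q) = eval w Q := by
    have h1 : (eval ![x, y]).comp (aeval u : MvPolynomial (Fin 2) ℂ →ₐ[ℂ] ChartRing).toRingHom =
        eval w := by
      ext i
      · simp
      · simpa using hu i
    exact congrArg (fun φ : ChartRing →+* ℂ => φ Q) h1
  obtain ⟨i, j⟩ := c
  rw [shear, map_mul, map_mul, h _ (if i = 0 then ![1, x] else ![x, 1])]
  · fin_cases i <;> fin_cases j <;> simp
  · intro k
    fin_cases i <;> fin_cases k <;> simp

theorem eval_smul_of_isHomogeneous {Q : MvPolynomial (Fin 2) ℂ} {n : ℕ} (hQ : Q.IsHomogeneous n)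
    {x : ℂ} (hx : x ≠ 0) (y : ℂ) : eval ![x, y] Q = x ^ n * eval ![1, y * x⁻¹] Q := by
  rw [eval_eq', eval_eq', Finset.mul_sum]
  refine Finset.sum_congr rfl fun d hd => ?_
  have h := hQ (mem_support_iff.1 hd)
  simp only [Finsupp.weight_apply, Finsupp.sum_fintype, implies_true,
    Fin.sum_univ_two, Pi.one_apply, smul_eq_mul, mul_one] at h
  simp only [Fin.prod_univ_two, Matrix.cons_val_zero, Matrix.cons_val_one, one_pow]
  rw [← h, pow_add, mul_pow, inv_pow]
  field_simp

theorem exists_isHomogeneous (h : Polynomial ℂ) {n : ℕ} (hn : ∀ j, n < j → h.coeff j = 0) :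
    ∃ Q : MvPolynomial (Fin 2) ℂ, Q.IsHomogeneous n ∧ ∀ x, eval ![1, x] Q = h.eval x := by
  refine ⟨∑ j ∈ Finset.range (n + 1), C (h.coeff j) * X 0 ^ (n - j) * X 1 ^ j,
    IsHomogeneous.sum _ _ _ fun j hj => ?_, fun x => ?_⟩
  · have h1 := ((isHomogeneous_C (Fin 2) (h.coeff j)).mul
      (isHomogeneous_X_pow (R := ℂ) (0 : Fin 2) (n - j))).mul
        (isHomogeneous_X_pow (R := ℂ) (1 : Fin 2) j)
    rwa [zero_add, Nat.sub_add_cancel (Nat.lt_succ_iff.1 (Finset.mem_range.1 hj))] at h1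
  · rw [Polynomial.eval_eq_sum_range' (n := n + 1)
      (Nat.lt_succ_iff.2 (Polynomial.natDegree_le_iff_coeff_eq_zero.2 hn))]
    simp

/-- Expand the chart function in powers of y, with coefficients F_k(x) and G_k(x) in the charts (0,
0) and (1, 0). The fibre relation leaves k ≤ 2, the base relation kills k = 0 and k = 1 and bounds
the degree for k = 2. The clause for δ < 2 is separate because there the truncated δ − 2 is 0, and
homogeneity alone would still allow constants. -/
theorem exists_shear {δ : ℕ} {e : ℂ} {g : Chart → ChartRing}
    (hV : ∀ (i : Fin 2) (x y : ℂ), y ≠ 0 →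
      y ^ 2 * eval ![x, y⁻¹] (g (i, 1)) = -eval ![x, y] (g (i, 0)))
    (hH : ∀ x y : ℂ, x ≠ 0 → eval ![x⁻¹, x ^ δ * y] (g (1, 0)) =
      -(δ * x ^ (δ + 1) * y * e + x ^ (δ + 2) * eval ![x, y] (g (0, 0)))) :
    δ * e = 0 ∧ ∃ Q : MvPolynomial (Fin 2) ℂ, Q.IsHomogeneous (δ - 2) ∧ (δ < 2 → Q = 0) ∧
      ∀ c, g c = shear Q c := by
  set F := toBivariate (g (0, 0)) with hF
  set G := toBivariate (g (1, 0)) with hG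
  have hcoeff (k : ℕ) (x : ℂ) (hx : x ≠ 0) : x ^ (δ * k) * (G.coeff k).eval x⁻¹ =
      -(x ^ (δ + 2) * (F.coeff k).eval x) - if k = 1 then δ * x ^ (δ + 1) * e else 0 := by
    have h : (slice (g (1, 0)) x⁻¹).comp (Polynomial.C (x ^ δ) * Polynomial.X) =
        -(Polynomial.C (δ * x ^ (δ + 1) * e) * Polynomial.X +
          Polynomial.C (x ^ (δ + 2)) * slice (g (0, 0)) x) := by
      refine Polynomial.funext fun y => ?_
      simp only [Polynomial.eval_comp, Polynomial.eval_mul, Polynomial.eval_C, Polynomial.eval_X,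
        Polynomial.eval_neg, Polynomial.eval_add, eval_slice, hH x y hx]
      ring
    have h1 := congrArg (fun q => Polynomial.coeff q k) h
    simp only [Polynomial.comp_C_mul_X_coeff, Polynomial.coeff_neg, Polynomial.coeff_add,
      Polynomial.coeff_C_mul, coeff_slice, Polynomial.coeff_X, ← hF, ← hG] at h1
    rw [pow_mul, mul_comm, h1]
    rcases eq_or_ne k 1 with rfl | hk
    · simp
      ring
    · simp [hk, hk.symm]
  have hF0 : F.coeff 0 = 0 := by
    ext j
    refine coeff_eq_zero_of_inversion (g := -G.coeff 0) (m := δ + 2) (n := 0) (fun x hx => ?_)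
      (by omega)
    have := hcoeff 0 x hx
    simp at this ⊢
    linear_combination this
  -- For k = 1 the relation is x^(δ+1) (x F₁ + δe) = −x^δ G₁(1/x), so x F₁ + δe has no coefficient
  -- at all. Its constant term gives δe = 0.
  have hF1 : Polynomial.X * F.coeff 1 + Polynomial.C (δ * e) = 0 := by
    ext j
    refine coeff_eq_zero_of_inversion (g := -G.coeff 1) (m := δ + 1) (n := δ) (fun x hx => ?_)
      (by omega)
    have := hcoeff 1 x hx
    simp at this ⊢
    linear_combination this
  have he : δ * e = 0 := by
    simpa using congrArg (fun q => Polynomial.coeff q 0) hF1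
  have hF1' : F.coeff 1 = 0 := by
    rw [he] at hF1
    simpa using hF1
  -- Here x^(δ+2) F₂ = −x^(2δ) G₂(1/x), so only exponents j ≤ δ − 2 survive.
  have hF2 (j : ℕ) (hj : δ < j + 2) : (F.coeff 2).coeff j = 0 := by
    refine coeff_eq_zero_of_inversion (g := -G.coeff 2) (m := δ + 2) (n := δ * 2) (fun x hx => ?_)
      (by omega)
    have := hcoeff 2 x hx
    simp at this ⊢
    linear_combination this
  have hF3 (k : ℕ) (hk : 2 < k) : F.coeff k = 0 := by
    refine Polynomial.funext fun x => ?_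
    rw [hF, ← coeff_slice, Polynomial.eval_zero]
    refine coeff_slice_eq_zero (g := -g (0, 1)) (m := 0) (n := 2) (fun y hy => ?_) (by omega)
    have := hV 0 x y hy
    rw [map_neg]
    linear_combination this
  have h00 (x y : ℂ) : eval ![x, y] (g (0, 0)) = y ^ 2 * (F.coeff 2).eval x := by
    have h : slice (g (0, 0)) x = Polynomial.C ((F.coeff 2).eval x) * Polynomial.X ^ 2 := by
      ext k
      rw [coeff_slice, Polynomial.coeff_C_mul_X_pow, ← hF]
      rcases k with _ | _ | _ | k
      · simp [hF0]
      · simp [hF1']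
      · simp
      · simp [hF3]
    rw [← eval_slice, h, Polynomial.eval_C_mul, Polynomial.eval_X_pow, mul_comm]
  obtain ⟨Q, hQ, hQ2, hQF⟩ : ∃ Q : MvPolynomial (Fin 2) ℂ, Q.IsHomogeneous (δ - 2) ∧
      (δ < 2 → Q = 0) ∧ ∀ x, eval ![1, x] Q = (F.coeff 2).eval x := by
    by_cases hδ : δ < 2
    · have h : F.coeff 2 = 0 := Polynomial.ext fun j => hF2 j (by omega)
      exact ⟨0, isHomogeneous_zero _ _ _, fun _ => rfl, by simp [h]⟩
    · obtain ⟨Q, hQ, hQF⟩ := exists_isHomogeneous (F.coeff 2) (n := δ - 2)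
        fun j hj => hF2 j (by omega)
      exact ⟨Q, hQ, fun h => absurd h hδ, hQF⟩
  have hg00 : g (0, 0) = shear Q (0, 0) := by
    refine chartRing_ext fun x y => ?_
    simp [eval_shear, h00, hQF]
  have hg10 : g (1, 0) = shear Q (1, 0) := by
    refine chartRing_ext_torus fun x y hx hy => ?_
    -- This is the point of the chart (0, 0) that maps to (x, y). Homogeneity then turns Q(1, 1/x)
    -- into Q(x, 1).
    have h := hH x⁻¹ (x ^ δ * y) (inv_ne_zero hx)
    rw [h00, ← hQF, inv_inv, ← mul_assoc, ← mul_pow, inv_mul_cancel₀ hx, one_pow, one_mul] at h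
    rw [h, eval_shear]
    simp only [one_ne_zero, if_true, if_false]
    rw [eval_smul_of_isHomogeneous hQ hx, one_mul]
    by_cases hδ : δ < 2
    · have he' : (δ : ℂ) * x⁻¹ ^ (δ + 1) * (x ^ δ * y) * e = 0 := by
        linear_combination x⁻¹ ^ (δ + 1) * (x ^ δ * y) * he
      rw [he', hQ2 hδ]
      simp
    · obtain ⟨n, rfl⟩ : ∃ n, δ = n + 2 := ⟨δ - 2, by omega⟩
      have he' : ((n + 2 : ℕ) : ℂ) * x⁻¹ ^ (n + 2 + 1) * (x ^ (n + 2) * y) * e = 0 := by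
        linear_combination x⁻¹ ^ (n + 2 + 1) * (x ^ (n + 2) * y) * he
      rw [he']
      simp only [Nat.add_sub_cancel]
      rw [inv_pow, pow_add x n 2, pow_add, pow_add]
      field_simp
      rw [zero_add]
  have hi0 (i : Fin 2) : g (i, 0) = shear Q (i, 0) := by
    fin_cases i
    · exact hg00
    · exact hg10
  refine ⟨he, Q, hQ, hQ2, fun c => ?_⟩
  obtain ⟨i, j⟩ := c
  fin_cases j
  · exact hi0 i
  · refine chartRing_ext_torus fun x y _ hy => ?_
    have h := hV i x y⁻¹ (inv_ne_zero hy)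
    rw [inv_inv, hi0, eval_shear] at h
    rw [← mul_right_inj' (pow_ne_zero 2 (inv_ne_zero hy)), eq_comm]
    refine Eq.trans ?_ h.symm
    rw [eval_shear]
    simp

/-- Global endomorphisms of the tangent bundle in the four charts. -/
theorem end_eq {δ : ℕ} (Φ : endT δ) : ∃ (a d : ℂ) (Q : MvPolynomial (Fin 2) ℂ),
    (δ ≠ 0 → a = d) ∧ Q.IsHomogeneous (δ - 2) ∧ (δ < 2 → Q = 0) ∧
      ∀ c, Φ.1 c = !![C a, 0; shear Q c, C d] := by
  have h0 := end_upper_eq_zero Φ (0, 0)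
  have h1 := end_upper_eq_zero Φ (1, 0)
  obtain ⟨a, ha⟩ := exists_eq_C (δ := δ) (f := fun c => Φ.1 c 0 0)
    (fun i x y hy => (end_vertical Φ i x hy).1) fun x y hx => (end_horizontal Φ h0 h1 hx y).1
  obtain ⟨d, hd⟩ := exists_eq_C (δ := δ) (f := fun c => Φ.1 c 1 1)
    (fun i x y hy => (end_vertical Φ i x hy).2.2.2) fun x y hx => (end_horizontal Φ h0 h1 hx y).2.1
  obtain ⟨he, Q, hQ, hQ2, hg⟩ := exists_shear (δ := δ) (e := a - d) (g := fun c => Φ.1 c 1 0)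
    (fun i x y hy => (end_vertical Φ i x hy).2.2.1) fun x y hx => by
      rw [(end_horizontal Φ h0 h1 hx y).2.2, ha, hd, eval_C, eval_C]
  refine ⟨a, d, Q, fun hδ => ?_, hQ, hQ2, fun c => ?_⟩
  · exact sub_eq_zero.1 ((mul_eq_zero.1 he).resolve_left (Nat.cast_ne_zero.2 hδ))
  · ext1 k l
    fin_cases k <;> fin_cases l
    · exact ha c
    · exact end_upper_eq_zero Φ c
    · exact hg c
    · exact hd c

/-! ### Matrices of endomorphisms -/

theorem eq_zero_of_eval_one_eq_zero {Q : MvPolynomial (Fin 2) ℂ} {n : ℕ} (hQ : Q.IsHomogeneous n)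
    (h : ∀ x : ℂ, x ≠ 0 → eval ![1, x] Q = 0) : Q = 0 := by
  refine chartRing_ext_torus fun x y hx hy => ?_
  rw [eval_smul_of_isHomogeneous hQ hx, h _ (mul_ne_zero hy (inv_ne_zero hx)), mul_zero, map_zero]

theorem shear_ne_zero {Q : MvPolynomial (Fin 2) ℂ} {n : ℕ} (hQ : Q.IsHomogeneous n) (h : Q ≠ 0)
    (c : Chart) : shear Q c ≠ 0 := by
  intro h0
  refine h (eq_zero_of_eval_one_eq_zero hQ fun x hx => ?_)
  obtain ⟨i, j⟩ := c
  fin_cases i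
  · have h1 := eval_shear Q (0, j) x 1
    rw [show shear Q (0, j) = 0 from h0] at h1
    fin_cases j <;> simpa [eq_comm] using h1
  · have h1 := eval_shear Q (1, j) x⁻¹ 1
    rw [show shear Q (1, j) = 0 from h0] at h1
    have h2 := eval_smul_of_isHomogeneous hQ (inv_ne_zero hx) 1
    have h3 : eval ![x⁻¹, 1] Q = 0 := by fin_cases j <;> simpa [eq_comm] using h1
    rw [h3, one_mul, inv_inv] at h2
    exact (mul_eq_zero.1 h2.symm).resolve_left (pow_ne_zero n (inv_ne_zero hx))

theorem shear_zero (c : Chart) : shear 0 c = 0 := by simp [shear]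

theorem hasMatrix_matrixZero {Φ : endT 0} {a d : ℂ} (h : ∀ c, Φ.1 c = !![C a, 0; 0, C d]) :
    HasMatrix Φ (matrixZero a d) := by
  intro c p v
  rw [← vec_two_eta p, h, fderiv_coord_lift, fderiv_coord_lift]
  obtain ⟨i, j⟩ := c
  fin_cases i <;> fin_cases j <;> funext k <;> fin_cases k <;>
    simp [matrixZero, evalMat, Matrix.mulVec, dotProduct, Fin.sum_univ_succ, Matrix.diagonal,
      xIdx] <;> ring

theorem matrixZero_unique {Φ : endT 0} {a d a' d' : ℂ} (h : ∀ c, Φ.1 c = !![C a, 0; 0, C d])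
    (h' : HasMatrix Φ (matrixZero a' d')) : a' = a ∧ d' = d := by
  -- The vectors ∂/∂X₁ and ∂/∂Y₁ at the origin of the chart map to its two coordinate directions, so
  -- they read off a and d.
  have h1 := h' (0, 0) ![0, 0] ![0, 1, 0, 0]
  have h3 := h' (0, 0) ![0, 0] ![0, 0, 0, 1]
  rw [h, fderiv_coord_lift, fderiv_coord_lift] at h1 h3
  have h10 := congrFun h1 0
  have h31 := congrFun h3 1
  simp [matrixZero, evalMat, Matrix.mulVec, dotProduct, Fin.sum_univ_succ, Matrix.diagonal,
    xIdx] at h10 h31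
  exact ⟨h10.symm, h31.symm⟩

theorem eval_lift_rename (Q : MvPolynomial (Fin 2) ℂ) (c : Chart) (x y : ℂ) :
    eval (lift c ![x, y]) (rename xIdx Q) = eval (if c.1 = 0 then ![1, x] else ![x, 1]) Q := by
  rw [eval_rename]
  congr 2
  obtain ⟨i, j⟩ := c
  funext k
  fin_cases i <;> fin_cases k <;> simp [lift, xIdx]

theorem hasMatrix_matrixTwo {δ : ℕ} {Φ : endT δ} {a : ℂ} {Q : MvPolynomial (Fin 2) ℂ}
    (h : ∀ c, Φ.1 c = !![C a, 0; shear Q c, C a]) : HasMatrix Φ (matrixTwo a Q) := by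
  intro c p v
  rw [← vec_two_eta p, h, fderiv_coord_lift, fderiv_coord_lift]
  have h1 := eval_shear Q c (p 0) (p 1)
  have h2 := eval_lift_rename Q c (p 0) (p 1)
  obtain ⟨i, j⟩ := c
  fin_cases i <;> fin_cases j <;> funext k <;> fin_cases k <;>
    simp [matrixTwo, evalMat, Matrix.mulVec, dotProduct, Fin.sum_univ_succ, xIdx] at h1 h2 ⊢ <;>
    (try rw [h1, h2]) <;> (try simp [lift]) <;> ring

theorem matrixTwo_unique {δ : ℕ} {Φ : endT δ} {a a' : ℂ} {Q Q' : MvPolynomial (Fin 2) ℂ} {n : ℕ}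
    (h : ∀ c, Φ.1 c = !![C a, 0; shear Q c, C a]) (hQ : Q.IsHomogeneous n)
    (hQ' : Q'.IsHomogeneous n) (h' : HasMatrix Φ (matrixTwo a' Q')) : a' = a ∧ Q' = Q := by
  have key (x : ℂ) : a' = a ∧ eval ![1, x] Q' = eval ![1, x] Q := by
    -- Taking y = 1 makes the factor y² equal to 1: the first coordinate reads off a, the second
    -- Q(1, x).
    have h1 := h' (0, 0) ![x, 1] ![0, 1, 0, 0]
    rw [h, fderiv_coord_lift, fderiv_coord_lift] at h1
    have h10 := congrFun h1 0
    have h11 := congrFun h1 1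
    have h2 := eval_shear Q (0, 0) x 1
    have h3 := eval_lift_rename Q' (0, 0) x 1
    simp [matrixTwo, evalMat, Matrix.mulVec, dotProduct, Fin.sum_univ_succ, xIdx] at h10 h11 h2 h3
    rw [h3, h2] at h11
    refine ⟨h10.symm, ?_⟩
    simpa [lift] using h11.symm
  refine ⟨(key 0).1, sub_eq_zero.1 (eq_zero_of_eval_one_eq_zero (hQ'.sub hQ) fun x _ => ?_)⟩
  rw [map_sub, (key x).2, sub_self]

/-- By Cayley–Hamilton, Φ (tr Φ − Φ) = det Φ with constant trace a + d and determinant ad, so the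
inverse is again a global endomorphism. -/
theorem isUnit_of_triangular {δ : ℕ} {Φ : endT δ} {a d : ℂ} {g : Chart → ChartRing}
    (h : ∀ c, Φ.1 c = !![C a, 0; g c, C d]) (ha : a ≠ 0) (hd : d ≠ 0) : IsUnit Φ := by
  have key : Φ * (algebraMap ℂ _ (a + d) - Φ) = algebraMap ℂ _ (a * d) := by
    refine Subtype.ext (funext fun c => ?_)
    change Φ.1 c * (algebraMap ℂ (Matrix (Fin 2) (Fin 2) ChartRing) (a + d) - Φ.1 c) =
      algebraMap ℂ (Matrix (Fin 2) (Fin 2) ChartRing) (a * d)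
    rw [h]
    ext1 k l
    fin_cases k <;> fin_cases l <;>
      simp [Matrix.mul_apply, Fin.sum_univ_two, Matrix.algebraMap_matrix_apply, algebraMap_eq] <;>
      ring
  have hcomm : Commute Φ (algebraMap ℂ _ (a + d) - Φ) :=
    (Algebra.commute_algebraMap_right (a + d) Φ).sub_right (Commute.refl Φ)
  exact (hcomm.isUnit_mul_iff.1 (key ▸ (mul_ne_zero ha hd).isUnit.map (algebraMap ℂ (endT δ)))).1

theorem ne_zero_of_isUnit {δ : ℕ} {Φ : endT δ} {a d : ℂ} {g : Chart → ChartRing}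
    (h : ∀ c, Φ.1 c = !![C a, 0; g c, C d]) (hu : IsUnit Φ) : a ≠ 0 ∧ d ≠ 0 := by
  have h1 : IsUnit (Φ.1 (0, 0)) := (hu.map (endT δ).val).map (Pi.evalMonoidHom _ ((0, 0) : Chart))
  rw [h, Matrix.isUnit_iff_isUnit_det, Matrix.det_fin_two_of, zero_mul, sub_zero, ← C_mul] at h1
  have h2 := h1.ne_zero
  rw [Ne, C_eq_zero, mul_eq_zero, not_or] at h2
  exact h2

/-! ### Sections -/

theorem singSubscheme_applyEnd {δ : ℕ} {d₁ d₂ : ℤ} (Φ : endT δ) (s : sections δ d₁ d₂) :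
    SingSubscheme s (applyEnd Φ s) := by
  intro c
  refine Ideal.span_le.2 ?_
  rintro _ ⟨k, rfl⟩
  change ∑ l, Φ.1 c k l * s.1 c l ∈ singIdeal s c
  exact Ideal.sum_mem _ fun l _ => Ideal.mul_mem_left _ _ (Ideal.subset_span (Set.mem_range_self l))

/-- The inclusion for Φ at s and the inclusion for Φ⁻¹ at Φ(s) are opposite. -/
theorem singEq_applyEnd {δ : ℕ} {d₁ d₂ : ℤ} {Φ : endT δ} (hu : IsUnit Φ) (s : sections δ d₁ d₂) :
    SingEq s (applyEnd Φ s) := by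
  intro c
  obtain ⟨u, rfl⟩ := hu
  refine le_antisymm ?_ (singSubscheme_applyEnd u.1 s c)
  have h : applyEnd u.2 (applyEnd u.1 s) = s := by
    refine Subtype.ext (funext fun c => ?_)
    have h1 : u.2.1 c * u.1.1 c = 1 := congrFun (congrArg Subtype.val u.4) c
    change (u.2.1 c).mulVec ((u.1.1 c).mulVec (s.1 c)) = s.1 c
    rw [Matrix.mulVec_mulVec, h1, Matrix.one_mulVec]
  have h2 := singSubscheme_applyEnd u.2 (applyEnd u.1 s) c
  rwa [h] at h2

theorem applyEnd_fst {δ : ℕ} {d₁ d₂ : ℤ} {Φ : endT δ} {a d : ℂ} {g : Chart → ChartRing}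
    (h : ∀ c, Φ.1 c = !![C a, 0; g c, C d]) (s : sections δ d₁ d₂) (c : Chart) :
    (applyEnd Φ s).1 c 0 = C a * s.1 c 0 := by
  change (Φ.1 c).mulVec (s.1 c) 0 = _
  simp [h, Matrix.mulVec, dotProduct, Fin.sum_univ_two]

theorem applyEnd_snd {δ : ℕ} {d₁ d₂ : ℤ} {Φ : endT δ} {a d : ℂ} {g : Chart → ChartRing}
    (h : ∀ c, Φ.1 c = !![C a, 0; g c, C d]) (s : sections δ d₁ d₂) (c : Chart) :
    (applyEnd Φ s).1 c 1 = g c * s.1 c 0 + C d * s.1 c 1 := by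
  change (Φ.1 c).mulVec (s.1 c) 1 = _
  simp [h, Matrix.mulVec, dotProduct, Fin.sum_univ_two]

theorem section_ext {δ : ℕ} {d₁ d₂ : ℤ} {s t : sections δ d₁ d₂} (h0 : ∀ c, s.1 c 0 = t.1 c 0)
    (h1 : ∀ c, s.1 c 1 = t.1 c 1) : s = t :=
  Subtype.ext <| funext fun c => funext fun k => by
    fin_cases k
    · exact h0 c
    · exact h1 c

theorem sameFoliation_of_smul {δ : ℕ} {d₁ d₂ : ℤ} {s t : sections δ d₁ d₂} {a : ℂ} (ha : a ≠ 0)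
    (hs : s ≠ 0) (h : t = a • s) : SameFoliation s t := by
  refine ⟨hs, h ▸ smul_ne_zero ha hs, ?_⟩
  rw [Projectivization.mk_eq_mk_iff']
  exact ⟨a⁻¹, by rw [h, inv_smul_smul₀ ha]⟩

theorem SameFoliation.exists_eq_smul {δ : ℕ} {d₁ d₂ : ℤ} {s t : sections δ d₁ d₂}
    (h : SameFoliation s t) : ∃ a : ℂ, ∀ c k, t.1 c k = C a * s.1 c k := by
  obtain ⟨hs, ht, h⟩ := h
  obtain ⟨a, ha⟩ := (Projectivization.mk_eq_mk_iff' ℂ _ _ ht hs).1 h.symm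
  refine ⟨a, fun c k => ?_⟩
  rw [← ha, ← smul_eq_C_mul]
  rfl

theorem singDim_eq_one {δ : ℕ} {d₁ d₂ : ℤ} {s : sections δ d₁ d₂} {f : Chart → ChartRing}
    (hs : ∀ c, singIdeal s c = Ideal.span {f c}) (hf : ∀ c, f c ≠ 0) {c : Chart}
    (hc : ¬ IsUnit (f c)) : singDim s = 1 := by
  refine le_antisymm (iSup_le fun e => ?_) (le_iSup_of_le c ?_)
  · rw [hs]
    exact ringKrullDim_quotient_span_singleton_le (hf e)
  · rw [hs]
    exact one_le_ringKrullDim_quotient_span_singleton (hf c) hc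

theorem singIdeal_of_fst {δ : ℕ} {d₁ d₂ : ℤ} {s : sections δ d₁ d₂} {c : Chart}
    (h : s.1 c 1 = 0) : singIdeal s c = Ideal.span {s.1 c 0} := by
  refine le_antisymm (Ideal.span_le.2 ?_) (Ideal.span_mono ?_)
  · rintro _ ⟨k, rfl⟩
    fin_cases k
    · exact Ideal.subset_span rfl
    · exact h.symm ▸ Ideal.zero_mem _
  · rintro _ rfl
    exact ⟨0, rfl⟩

theorem singIdeal_of_snd {δ : ℕ} {d₁ d₂ : ℤ} {s : sections δ d₁ d₂} {c : Chart}
    (h : s.1 c 0 = 0) : singIdeal s c = Ideal.span {s.1 c 1} := by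
  refine le_antisymm (Ideal.span_le.2 ?_) (Ideal.span_mono ?_)
  · rintro _ ⟨k, rfl⟩
    fin_cases k
    · exact h.symm ▸ Ideal.zero_mem _
    · exact Ideal.subset_span rfl
  · rintro _ rfl
    exact ⟨1, rfl⟩

/-! ### Bi-homogeneous polynomials in the charts -/

/-- The expression in the chart `c` of a bi-homogeneous polynomial. -/
def dehomogenize (c : Chart) : CoxRing →ₐ[ℂ] ChartRing :=
  aeval ![if c.1 = 0 then 1 else X 0, if c.1 = 0 then X 0 else 1,
    if c.2 = 0 then 1 else X 1, if c.2 = 0 then X 1 else 1]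

theorem eval_dehomogenize (c : Chart) (p : Fin 2 → ℂ) (G : CoxRing) :
    eval p (dehomogenize c G) = eval (lift c p) G := by
  have h : (eval p).comp (dehomogenize c).toRingHom = eval (lift c p) := by
    ext i
    · simp
    · obtain ⟨i', j'⟩ := c
      fin_cases i' <;> fin_cases j' <;> fin_cases i <;> simp [dehomogenize, lift]
  exact congrArg (fun φ : CoxRing →+* ℂ => φ G) h

theorem BiHomogeneous.eval_torus {δ : ℕ} {G : CoxRing} {e₁ e₂ : ℤ} (hG : BiHomogeneous δ G e₁ e₂)
    {l m : ℂ} (hl : l ≠ 0) (hm : m ≠ 0) (P : Fin 4 → ℂ) :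
    eval ![l * P 0, l * P 1, m * P 2, (l ^ δ)⁻¹ * m * P 3] G = l ^ e₁ * m ^ e₂ * eval P G := by
  rw [eval_eq', eval_eq', Finset.mul_sum]
  refine Finset.sum_congr rfl fun d hd => ?_
  have h := hG (mem_support_iff.1 hd)
  simp only [Finsupp.weight_apply, Finsupp.sum_fintype, zero_smul, implies_true,
    Fin.sum_univ_four, weight] at h
  simp [Prod.ext_iff] at h
  obtain ⟨h1, h2⟩ := h
  have e1 : l ^ e₁ = l ^ d 0 * l ^ d 1 * ((l ^ δ)⁻¹) ^ d 3 := by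
    rw [← h1, ← sub_eq_add_neg, zpow_sub₀ hl, zpow_add₀ hl, mul_comm (d 3 : ℤ), zpow_mul]
    simp [div_eq_mul_inv]
  have e2 : m ^ e₂ = m ^ d 2 * m ^ d 3 := by
    rw [← h2, zpow_add₀ hm]
    simp
  rw [e1, e2]
  simp [Fin.prod_univ_four, mul_pow]
  ring

/-- The torus moves every point with nonzero coordinates to a normalized representative in the
chart, and G changes by a nonzero factor. So G vanishes off the coordinate hyperplanes, hence
everywhere. -/
theorem BiHomogeneous.eq_zero {δ : ℕ} {G : CoxRing} {e₁ e₂ : ℤ} (hG : BiHomogeneous δ G e₁ e₂)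
    {c : Chart} (h : dehomogenize c G = 0) : G = 0 := by
  have h1 : (X 0 * X 1 * X 2 * X 3 : CoxRing) * G = 0 := by
    refine MvPolynomial.funext fun P => ?_
    by_contra hP
    simp only [map_mul, eval_X, map_zero, mul_eq_zero, not_or] at hP
    obtain ⟨⟨⟨⟨h0, h1⟩, h2⟩, h3⟩, hG0⟩ := hP
    have key (l m : ℂ) (hl : l ≠ 0) (hm : m ≠ 0) (p : Fin 2 → ℂ)
        (hp : ![l * lift c p 0, l * lift c p 1, m * lift c p 2, (l ^ δ)⁻¹ * m * lift c p 3] = P) :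
        False := by
      have := hG.eval_torus hl hm (lift c p)
      rw [hp, ← eval_dehomogenize, h, map_zero, mul_zero] at this
      exact hG0 this
    obtain ⟨i, j⟩ := c
    fin_cases i <;> fin_cases j
    · refine key (P 0) (P 2) h0 h2 ![P 1 / P 0, P 0 ^ δ * P 3 / P 2] ?_
      funext k
      fin_cases k <;> simp [lift] <;> field_simp
    · refine key (P 0) (P 0 ^ δ * P 3) h0 (by simp [h0, h3]) ![P 1 / P 0, P 2 / (P 0 ^ δ * P 3)] ?_
      funext k
      fin_cases k <;> simp [lift] <;> field_simp
    · refine key (P 1) (P 2) h1 h2 ![P 0 / P 1, P 1 ^ δ * P 3 / P 2] ?_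
      funext k
      fin_cases k <;> simp [lift] <;> field_simp
    · refine key (P 1) (P 1 ^ δ * P 3) h1 (by simp [h1, h3]) ![P 0 / P 1, P 2 / (P 1 ^ δ * P 3)] ?_
      funext k
      fin_cases k <;> simp [lift] <;> field_simp
  exact (mul_eq_zero.1 h1).resolve_left (by simp)

theorem BiHomogeneous.nonneg {G : CoxRing} {e₁ e₂ : ℤ} (hG : BiHomogeneous 0 G e₁ e₂)
    (h : G ≠ 0) : 0 ≤ e₁ ∧ 0 ≤ e₂ := by
  obtain ⟨d, hd⟩ := ne_zero_iff.1 h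
  have h := hG hd
  simp only [Finsupp.weight_apply, Finsupp.sum_fintype, zero_smul, implies_true,
    Fin.sum_univ_four, weight] at h
  simp [Prod.ext_iff] at h
  omega

theorem not_isUnit_C_mul_X_pow (k : ℂ) (i : Fin 2) {n : ℕ} (hn : n ≠ 0) :
    ¬ IsUnit (C k * X i ^ n : ChartRing) := by
  intro h
  have h1 := h.map (eval (0 : Fin 2 → ℂ))
  simp [hn] at h1

/-- A unit on the chart (0, 0) is a constant k; the section is then k x^e₁ on the chart (1, 0),
where it vanishes at x = 0. -/
theorem BiHomogeneous.exists_not_isUnit_of_fst {G : CoxRing} {e₁ e₂ : ℤ}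
    (hG : BiHomogeneous 0 G e₁ e₂) (he : 0 < e₁) : ∃ c, ¬ IsUnit (dehomogenize c G) := by
  by_cases hu : IsUnit (dehomogenize (0, 0) G)
  · obtain ⟨k, -, hk⟩ := isUnit_iff_eq_C_of_isReduced.1 hu
    obtain ⟨n, rfl⟩ := Int.eq_ofNat_of_zero_le he.le
    refine ⟨(1, 0), ?_⟩
    have h : dehomogenize (1, 0) G = C k * X 0 ^ n := by
      refine chartRing_ext_torus fun x y hx _ => ?_
      have h1 := hG.eval_torus hx one_ne_zero (lift (0, 0) ![x⁻¹, y])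
      rw [← eval_dehomogenize, hk, eval_C] at h1
      rw [eval_dehomogenize]
      simp [lift, hx] at h1 ⊢
      rw [h1, mul_comm]
    rw [h]
    exact not_isUnit_C_mul_X_pow k 0 (by omega)
  · exact ⟨_, hu⟩

theorem BiHomogeneous.exists_not_isUnit_of_snd {G : CoxRing} {e₁ e₂ : ℤ}
    (hG : BiHomogeneous 0 G e₁ e₂) (he : 0 < e₂) : ∃ c, ¬ IsUnit (dehomogenize c G) := by
  by_cases hu : IsUnit (dehomogenize (0, 0) G)
  · obtain ⟨k, -, hk⟩ := isUnit_iff_eq_C_of_isReduced.1 hu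
    obtain ⟨n, rfl⟩ := Int.eq_ofNat_of_zero_le he.le
    refine ⟨(0, 1), ?_⟩
    have h : dehomogenize (0, 1) G = C k * X 1 ^ n := by
      refine chartRing_ext_torus fun x y _ hy => ?_
      have h1 := hG.eval_torus one_ne_zero hy (lift (0, 0) ![x, y⁻¹])
      rw [← eval_dehomogenize, hk, eval_C] at h1
      rw [eval_dehomogenize]
      simp [lift, hy] at h1 ⊢
      rw [h1, mul_comm]
    rw [h]
    exact not_isUnit_C_mul_X_pow k 1 (by omega)
  · exact ⟨_, hu⟩

/-! ### Sections represented by affine vector fields -/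

variable {δ : ℕ} {d₁ d₂ : ℤ}

theorem BiHomogeneous.sub {G H : CoxRing} {e₁ e₂ : ℤ} (hG : BiHomogeneous δ G e₁ e₂)
    (hH : BiHomogeneous δ H e₁ e₂) : BiHomogeneous δ (G - H) e₁ e₂ :=
  (weightedHomogeneousSubmodule ℂ (weight δ) (e₁, e₂)).sub_mem hG hH

theorem BiHomogeneous.X_mul {G : CoxRing} {e₁ e₂ f₁ f₂ : ℤ} (hG : BiHomogeneous δ G e₁ e₂)
    (i : Fin 4) (h₁ : (weight δ i).1 + e₁ = f₁) (h₂ : (weight δ i).2 + e₂ = f₂) :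
    BiHomogeneous δ (X i * G) f₁ f₂ := by
  subst h₁ h₂
  exact (isWeightedHomogeneous_X ℂ (weight δ) i).mul hG

theorem AffineVectorField.biHomogeneous_fst (F : AffineVectorField δ d₁ d₂) :
    BiHomogeneous δ (X 0 * F.V₁ - X 1 * F.V₀) (d₁ + 2) d₂ :=
  (F.hV₁.X_mul 0 (by simp [weight]; ring) (by simp [weight])).sub
    (F.hV₀.X_mul 1 (by simp [weight]; ring) (by simp [weight]))

theorem AffineVectorField.biHomogeneous_snd (F : AffineVectorField 0 d₁ d₂) :
    BiHomogeneous 0 (X 2 * F.W₁ - X 3 * F.W₀) d₁ (d₂ + 2) :=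
  (F.hW₁.X_mul 2 (by simp [weight]) (by simp [weight]; ring)).sub
    (F.hW₀.X_mul 3 (by simp [weight]) (by simp [weight]; ring))

/-- The x-component of dπ at a normalized point is V_{1−i} − x V_i, which is ±(X₀V₁ − X₁V₀) since
X_i = 1 and X_{1−i} = x. The vanishing of this form thus means that s is tangent to the fibres,
whichever X represents s. -/
theorem Represents.fst {F : AffineVectorField δ d₁ d₂} {s : sections δ d₁ d₂}
    (h : Represents F s) (c : Chart) :
    s.1 c 0 = C (if c.1 = 0 then 1 else -1) * dehomogenize c (X 0 * F.V₁ - X 1 * F.V₀) := by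
  refine chartRing_ext fun x y => ?_
  have h0 := congrFun (h c ![x, y]) 0
  rw [fderiv_coord_lift] at h0
  rw [map_mul, eval_dehomogenize]
  refine h0.trans ?_
  obtain ⟨i, j⟩ := c
  fin_cases i <;> simp [evalVec, lift, xIdx]

theorem Represents.snd {F : AffineVectorField 0 d₁ d₂} {s : sections 0 d₁ d₂}
    (h : Represents F s) (c : Chart) :
    s.1 c 1 = C (if c.2 = 0 then 1 else -1) * dehomogenize c (X 2 * F.W₁ - X 3 * F.W₀) := by
  refine chartRing_ext fun x y => ?_
  have h0 := congrFun (h c ![x, y]) 1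
  rw [fderiv_coord_lift] at h0
  rw [map_mul, eval_dehomogenize]
  refine h0.trans ?_
  obtain ⟨i, j⟩ := c
  fin_cases j <;> simp [evalVec, lift]

theorem C_sign_ne_zero (i : Fin 2) : (C (if i = 0 then 1 else -1) : ChartRing) ≠ 0 := by
  split_ifs <;> simp

theorem Represents.fst_eq_zero_iff {F : AffineVectorField δ d₁ d₂} {s : sections δ d₁ d₂}
    (h : Represents F s) (c : Chart) : s.1 c 0 = 0 ↔ X 0 * F.V₁ - X 1 * F.V₀ = 0 := by
  rw [h.fst, mul_eq_zero, or_iff_right (C_sign_ne_zero _)]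
  exact ⟨fun h => F.biHomogeneous_fst.eq_zero h, fun h => by rw [h, map_zero]⟩

theorem Represents.snd_eq_zero_iff {F : AffineVectorField 0 d₁ d₂} {s : sections 0 d₁ d₂}
    (h : Represents F s) (c : Chart) : s.1 c 1 = 0 ↔ X 2 * F.W₁ - X 3 * F.W₀ = 0 := by
  rw [h.snd, mul_eq_zero, or_iff_right (C_sign_ne_zero _)]
  exact ⟨fun h => F.biHomogeneous_snd.eq_zero h, fun h => by rw [h, map_zero]⟩

/-- The singular scheme is the curve X₀V₁ − X₁V₀ = 0. It is not empty: one of V₀, V₁ is nonzero, so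
d₁ + 1 ≥ 0, and the equation has positive degree d₁ + 2 in X₀, X₁. -/
theorem singDim_eq_one_of_fst {F : AffineVectorField 0 d₁ d₂} {s : sections 0 d₁ d₂}
    (h : Represents F s) (hs : s ≠ 0) (h1 : ∀ c, s.1 c 1 = 0) : singDim s = 1 := by
  have hG : X 0 * F.V₁ - X 1 * F.V₀ ≠ 0 := fun hG =>
    hs (section_ext (fun c => (h.fst_eq_zero_iff c).2 hG) h1)
  have he : 0 < d₁ + 2 := by
    by_cases h0 : F.V₀ = 0
    · have := BiHomogeneous.nonneg F.hV₁ fun h1 => hG (by rw [h0, h1, mul_zero, mul_zero, sub_zero])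
      omega
    · have := BiHomogeneous.nonneg F.hV₀ h0
      omega
  obtain ⟨c, hc⟩ := F.biHomogeneous_fst.exists_not_isUnit_of_fst he
  refine singDim_eq_one (fun c => singIdeal_of_fst (h1 c))
    (fun c => (h.fst_eq_zero_iff c).not.2 hG) (c := c) ?_
  rw [h.fst]
  exact fun hu => hc (isUnit_of_mul_isUnit_right hu)

theorem singDim_eq_one_of_snd {F : AffineVectorField 0 d₁ d₂} {s : sections 0 d₁ d₂}
    (h : Represents F s) (hs : s ≠ 0) (h0 : ∀ c, s.1 c 0 = 0) : singDim s = 1 := by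
  have hH : X 2 * F.W₁ - X 3 * F.W₀ ≠ 0 := fun hH =>
    hs (section_ext h0 (fun c => (h.snd_eq_zero_iff c).2 hH))
  have he : 0 < d₂ + 2 := by
    by_cases h0 : F.W₀ = 0
    · have := BiHomogeneous.nonneg F.hW₁ fun h1 => hH (by rw [h0, h1, mul_zero, mul_zero, sub_zero])
      omega
    · have := BiHomogeneous.nonneg F.hW₀ h0
      omega
  obtain ⟨c, hc⟩ := F.biHomogeneous_snd.exists_not_isUnit_of_snd he
  refine singDim_eq_one (fun c => singIdeal_of_snd (h0 c))
    (fun c => (h.snd_eq_zero_iff c).not.2 hH) (c := c) ?_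
  rw [h.snd]
  exact fun hu => hc (isUnit_of_mul_isUnit_right hu)

/-! ### Foliations preserved by an endomorphism -/

theorem applyEnd_eq_smul {Φ : endT δ} {a : ℂ} {g : Chart → ChartRing}
    (h : ∀ c, Φ.1 c = !![C a, 0; g c, C a]) {s : sections δ d₁ d₂}
    (hg : ∀ c, g c * s.1 c 0 = 0) : applyEnd Φ s = a • s := by
  refine section_ext (fun c => ?_) (fun c => ?_)
  · rw [applyEnd_fst h, ← smul_eq_C_mul]
    rfl
  · rw [applyEnd_snd h, hg, zero_add, ← smul_eq_C_mul]
    rfl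

theorem sameFoliation_diagonal_iff {Φ : endT 0} {a d : ℂ} (h : ∀ c, Φ.1 c = !![C a, 0; 0, C d])
    (ha : a ≠ 0) (hd : d ≠ 0) {s : sections 0 d₁ d₂} (hs : s ≠ 0) {F : AffineVectorField 0 d₁ d₂}
    (hF : Represents F s) : SameFoliation s (applyEnd Φ s) ↔
      a = d ∨ X 0 * F.V₁ - X 1 * F.V₀ = 0 ∨ X 2 * F.W₁ - X 3 * F.W₀ = 0 := by
  have e0 (c : Chart) : (applyEnd Φ s).1 c 0 = C a * s.1 c 0 :=
    applyEnd_fst (g := fun _ => 0) h s c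
  have e1 (c : Chart) : (applyEnd Φ s).1 c 1 = C d * s.1 c 1 := by
    rw [applyEnd_snd (g := fun _ => 0) h s c, zero_mul, zero_add]
  constructor
  · intro hst
    obtain ⟨b, hb⟩ := hst.exists_eq_smul
    by_contra hne
    -- With both coefficients nonzero in one chart, cancelling them identifies the factor b with a
    -- and with d.
    simp only [not_or, ← hF.fst_eq_zero_iff (0, 0), ← hF.snd_eq_zero_iff (0, 0)] at hne
    obtain ⟨had, h0, h1⟩ := hne
    have hab := mul_right_cancel₀ h0 ((e0 _).symm.trans (hb (0, 0) 0))
    have hdb := mul_right_cancel₀ h1 ((e1 _).symm.trans (hb (0, 0) 1))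
    exact had (C_injective _ _ (hab.trans hdb.symm))
  · rintro (rfl | h0 | h1)
    · exact sameFoliation_of_smul ha hs
        (applyEnd_eq_smul (g := fun _ => 0) h fun c => zero_mul _)
    · refine sameFoliation_of_smul hd hs (section_ext (fun c => ?_) fun c => ?_)
      · rw [e0, (hF.fst_eq_zero_iff c).2 h0, mul_zero]
        exact ((smul_eq_C_mul _ d).trans (by rw [(hF.fst_eq_zero_iff c).2 h0, mul_zero])).symm
      · rw [e1, ← smul_eq_C_mul]
        rfl
    · refine sameFoliation_of_smul ha hs (section_ext (fun c => ?_) fun c => ?_)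
      · rw [e0, ← smul_eq_C_mul]
        rfl
      · rw [e1, (hF.snd_eq_zero_iff c).2 h1, mul_zero]
        exact ((smul_eq_C_mul _ a).trans (by rw [(hF.snd_eq_zero_iff c).2 h1, mul_zero])).symm

theorem sameFoliation_shear_iff {Φ : endT δ} {a : ℂ} {Q : MvPolynomial (Fin 2) ℂ} {n : ℕ}
    (h : ∀ c, Φ.1 c = !![C a, 0; shear Q c, C a]) (hQ : Q.IsHomogeneous n) (ha : a ≠ 0)
    {s : sections δ d₁ d₂} (hs : s ≠ 0) {F : AffineVectorField δ d₁ d₂} (hF : Represents F s) :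
    SameFoliation s (applyEnd Φ s) ↔ Q = 0 ∨ X 0 * F.V₁ - X 1 * F.V₀ = 0 := by
  constructor
  · intro hst
    obtain ⟨b, hb⟩ := hst.exists_eq_smul
    by_contra hne
    rw [not_or, ← hF.fst_eq_zero_iff (0, 0)] at hne
    obtain ⟨hQ0, h0⟩ := hne
    have hab := mul_right_cancel₀ h0 ((applyEnd_fst h s _).symm.trans (hb (0, 0) 0))
    have h1 := (applyEnd_snd h s _).symm.trans (hb (0, 0) 1)
    -- The first coefficient forces b = a, so the second leaves a product of two nonzero polynomials
    -- equal to zero.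
    rw [hab, add_eq_right] at h1
    exact mul_ne_zero (shear_ne_zero hQ hQ0 _) h0 h1
  · rintro (rfl | h0)
    · exact sameFoliation_of_smul ha hs (applyEnd_eq_smul h fun c => by rw [shear_zero, zero_mul])
    · exact sameFoliation_of_smul ha hs
        (applyEnd_eq_smul h fun c => by rw [(hF.fst_eq_zero_iff c).2 h0, mul_zero])

theorem singDim_applyEnd_shear {Φ : endT δ} {Q : MvPolynomial (Fin 2) ℂ} {n : ℕ}
    (h : ∀ c, Φ.1 c = !![C 0, 0; shear Q c, C 0]) (hQ : Q.IsHomogeneous n)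
    {s : sections δ d₁ d₂} (hs : applyEnd Φ s ≠ 0) {F : AffineVectorField δ d₁ d₂}
    (hF : Represents F s) : singDim (applyEnd Φ s) = 1 := by
  have e0 (c : Chart) : (applyEnd Φ s).1 c 0 = 0 := by
    rw [applyEnd_fst h, map_zero, zero_mul]
  have e1 (c : Chart) : (applyEnd Φ s).1 c 1 = shear Q c * s.1 c 0 := by
    rw [applyEnd_snd h, map_zero, zero_mul, add_zero]
  have hQ0 : Q ≠ 0 := by
    rintro rfl
    exact hs (section_ext e0 fun c => by rw [e1, shear_zero, zero_mul]; rfl)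
  have hG : X 0 * F.V₁ - X 1 * F.V₀ ≠ 0 := fun hG =>
    hs (section_ext e0 fun c => by rw [e1, (hF.fst_eq_zero_iff c).2 hG, mul_zero]; rfl)
  refine singDim_eq_one (fun c => singIdeal_of_snd (e0 c)) (fun c => ?_) (c := (0, 0)) ?_
  · rw [e1]
    exact mul_ne_zero (shear_ne_zero hQ hQ0 c) ((hF.fst_eq_zero_iff c).not.2 hG)
  · rw [e1]
    intro hu
    -- In this chart the shear has the factor y², which vanishes at the origin.
    have h1 := (isUnit_of_mul_isUnit_left hu).map (eval ![(0 : ℂ), 0])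
    rw [eval_shear] at h1
    simp at h1

end Hirzebruch

end

/-! ### The theorem, by cases on δ -/

theorem mainTheorem3 (δ : ℕ) (d₁ d₂ : ℤ)
    (hrep : ∀ t : Hirzebruch.sections δ d₁ d₂,
      ∃ X : Hirzebruch.AffineVectorField δ d₁ d₂, Hirzebruch.Represents X t)
    (s : Hirzebruch.sections δ d₁ d₂) (Φ : Hirzebruch.endT δ) (hΦ : Φ ≠ 0) :
    -- (1)
    (Hirzebruch.SingSubscheme s (Hirzebruch.applyEnd Φ s) ∧
      (IsUnit Φ → Hirzebruch.SingEq s (Hirzebruch.applyEnd Φ s))) ∧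
    -- (2), `δ = 1`
    (δ = 1 → IsUnit Φ ∧ (s ≠ 0 → Hirzebruch.SameFoliation s (Hirzebruch.applyEnd Φ s))) ∧
    -- (2), `δ = 0`
    (δ = 0 →
      (∃! q : ℂ × ℂ, Hirzebruch.HasMatrix Φ (Hirzebruch.matrixZero q.1 q.2)) ∧
      ∀ a d : ℂ, Hirzebruch.HasMatrix Φ (Hirzebruch.matrixZero a d) → IsUnit Φ → s ≠ 0 →
        (∀ X : Hirzebruch.AffineVectorField δ d₁ d₂, Hirzebruch.Represents X s →
          (Hirzebruch.SameFoliation s (Hirzebruch.applyEnd Φ s) ↔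
            a = d ∨ MvPolynomial.X 0 * X.V₁ - MvPolynomial.X 1 * X.V₀ = 0 ∨
              MvPolynomial.X 2 * X.W₁ - MvPolynomial.X 3 * X.W₀ = 0)) ∧
        (Hirzebruch.singDim s ≤ 0 →
          (Hirzebruch.SameFoliation s (Hirzebruch.applyEnd Φ s) ↔ a = d))) ∧
    -- (2), `δ ≥ 2`
    (2 ≤ δ →
      (∃! q : ℂ × MvPolynomial (Fin 2) ℂ, q.2.IsHomogeneous (δ - 2) ∧
        Hirzebruch.HasMatrix Φ (Hirzebruch.matrixTwo q.1 q.2)) ∧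
      ∀ (a : ℂ) (Q : MvPolynomial (Fin 2) ℂ), Q.IsHomogeneous (δ - 2) →
        Hirzebruch.HasMatrix Φ (Hirzebruch.matrixTwo a Q) → IsUnit Φ → s ≠ 0 →
        ∀ X : Hirzebruch.AffineVectorField δ d₁ d₂, Hirzebruch.Represents X s →
          (Hirzebruch.SameFoliation s (Hirzebruch.applyEnd Φ s) ↔
            Q = 0 ∨ (Q ≠ 0 ∧ MvPolynomial.X 0 * X.V₁ - MvPolynomial.X 1 * X.V₀ = 0))) ∧
    -- (3)
    (¬ IsUnit Φ → Hirzebruch.applyEnd Φ s ≠ 0 →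
      Hirzebruch.singDim (Hirzebruch.applyEnd Φ s) = 1) := by
  obtain ⟨a, d, Q, had, hQ, hQ2, h⟩ := Hirzebruch.end_eq Φ
  refine ⟨⟨Hirzebruch.singSubscheme_applyEnd Φ s, fun hu => Hirzebruch.singEq_applyEnd hu s⟩,
    ?_, ?_, ?_, ?_⟩
  · rintro rfl
    obtain rfl := had one_ne_zero
    obtain rfl := hQ2 one_lt_two
    have ha : a ≠ 0 := by
      rintro rfl
      refine hΦ (Subtype.ext (funext fun c => (h c).trans ?_))
      rw [Hirzebruch.shear_zero, map_zero]
      ext1 k l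
      fin_cases k <;> fin_cases l <;> rfl
    exact ⟨Hirzebruch.isUnit_of_triangular h ha ha, fun hs => Hirzebruch.sameFoliation_of_smul ha hs
      (Hirzebruch.applyEnd_eq_smul h fun c => by rw [Hirzebruch.shear_zero, zero_mul])⟩
  · rintro rfl
    obtain rfl := hQ2 two_pos
    simp only [Hirzebruch.shear_zero] at h
    refine ⟨⟨(a, d), Hirzebruch.hasMatrix_matrixZero h, fun q hq => ?_⟩, fun a' d' hm hu hs => ?_⟩
    · obtain ⟨h1, h2⟩ := Hirzebruch.matrixZero_unique h hq
      exact Prod.ext h1 h2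
    obtain ⟨rfl, rfl⟩ := Hirzebruch.matrixZero_unique h hm
    obtain ⟨ha, hd⟩ := Hirzebruch.ne_zero_of_isUnit (g := fun _ => 0) h hu
    refine ⟨fun F hF => Hirzebruch.sameFoliation_diagonal_iff h ha hd hs hF, fun hdim => ?_⟩
    obtain ⟨F, hF⟩ := hrep s
    rw [Hirzebruch.sameFoliation_diagonal_iff h ha hd hs hF, or_iff_left]
    -- If one coefficient of s vanishes identically, the singular scheme is a curve, against the
    -- assumption on its dimension.
    rintro (h0 | h1)
    · rw [Hirzebruch.singDim_eq_one_of_snd hF hs fun c => (hF.fst_eq_zero_iff c).2 h0] at hdim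
      exact absurd hdim (by decide)
    · rw [Hirzebruch.singDim_eq_one_of_fst hF hs fun c => (hF.snd_eq_zero_iff c).2 h1] at hdim
      exact absurd hdim (by decide)
  · intro hδ
    obtain rfl := had (by omega)
    refine ⟨⟨(a, Q), ⟨hQ, Hirzebruch.hasMatrix_matrixTwo h⟩, fun q hq => ?_⟩,
      fun a' Q' hQ' hm hu hs F hF => ?_⟩
    · obtain ⟨h1, h2⟩ := Hirzebruch.matrixTwo_unique h hQ hq.1 hq.2
      exact Prod.ext h1 h2
    obtain ⟨rfl, rfl⟩ := Hirzebruch.matrixTwo_unique h hQ hQ' hm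
    rw [Hirzebruch.sameFoliation_shear_iff h hQ (Hirzebruch.ne_zero_of_isUnit h hu).1 hs hF]
    tauto
  · intro hu hs
    rcases Nat.eq_zero_or_pos δ with rfl | hδ
    · obtain rfl := hQ2 two_pos
      -- The section whose surviving coefficient must have positive degree is Φ(s), so Φ(s) itself
      -- is represented here.
      obtain ⟨F, hF⟩ := hrep (Hirzebruch.applyEnd Φ s)
      by_cases ha : a = 0
      · refine Hirzebruch.singDim_eq_one_of_snd hF hs fun c => ?_
        rw [Hirzebruch.applyEnd_fst h, ha, map_zero, zero_mul]
      · have hd : d = 0 := by_contra fun hd => hu (Hirzebruch.isUnit_of_triangular h ha hd)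
        refine Hirzebruch.singDim_eq_one_of_fst hF hs fun c => ?_
        rw [Hirzebruch.applyEnd_snd h, Hirzebruch.shear_zero, hd, map_zero, zero_mul, zero_mul,
          add_zero]
    -- For δ ≥ 1 a non-invertible Φ has zero diagonal, so only the shear is left. If δ = 1 the shear
    -- is zero too, and Φ(s) ≠ 0 is impossible.
    · obtain rfl := had hδ.ne'
      obtain rfl : a = 0 := by_contra fun ha => hu (Hirzebruch.isUnit_of_triangular h ha ha)
      obtain ⟨F, hF⟩ := hrep s
      exact Hirzebruch.singDim_applyEnd_shear h hQ hs hF
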